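/- **Theorem 1 (Main).** Let $G=(V,E)$ be a finite undirected graph without self-loops, with non-negative real edge weights of positive total. Write $A_{i,j}$ for the weight of the edge $\{i,j\}$ (and $A_{i,j}=0$ if $i,j$ are not adjacent), $d_i=\sum_j A_{i,j}$ for the weighted degree of $i$, and let the Max Cut optimum of $G$ be the maximum, over all $S\subseteq V$, of the total weight of the edges between $S$ and $V\setminus S$ divided by the total weight of all edges. There are an absolute constant $C$ and a randomized algorithm which, given any such graph $G$ (as a list of weighted edges) and any real $\delta>0$, always halts within $$C\cdot\max(1,\delta^{-2})\cdot(|V|+|E|)\cdot\log|V|$$ steps and has the following property: for every real $\varepsilon$ such that the Max Cut optimum of $G$ is at least $1-\varepsilon$ (the number $\varepsilon$ is not given to the algorithm), with probability at least $2/3$ over its coin flips the algorithm outputs a vector $y\in\{-1,0,1\}^V$ with $\sum_{i} d_i|y_i|>0$ and $$\frac{\sum_{i,j\in V} A_{i,j}\,|y_i+y_j|}{\sum_{i\in V} d_i\,|y_i|}\;\le\; 4\sqrt{\varepsilon}+\delta ,$$ where the sum in the numerator is over ordered pairs. Here an algorithm is a program for a real random-access machine with unit cost per operation: it has variables and arrays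 of natural numbers (with addition, truncated subtraction and comparison) and of real numbers (with $+,-,\times,/,\sqrt{\cdot}$ and comparison), natural numbers can be used as array indices and converted to reals, and one step can produce an independent fair random bit. -/

import Mathlib

/-- A finite undirected graph without self-loops, with non-negative real weights on its edges.
`weight i j` is the entry `A i j` of the weighted adjacency matrix. -/
structure WeightedGraph (V : Type*) where
  graph : SimpleGraph V
  weight : V → V → ℝ
  weight_symm : ∀ i j, weight i j = weight j i
  weight_nonneg : ∀ i j, 0 ≤ weight i j
  weight_eq_zero : ∀ i j, ¬ graph.Adj i j → weight i j = 0

namespace WeightedGraph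

section

variable {V : Type*} [Fintype V] [DecidableEq V] (G : WeightedGraph V)

/-- The weighted degree of a vertex. -/
def degree (i : V) : ℝ := ∑ j, G.weight i j

/-- The total weight of the edges; every edge occurs twice in the double sum. -/
noncomputable def totalWeight : ℝ := (∑ i, ∑ j, G.weight i j) / 2

/-- The total weight of the edges between `S` and its complement. -/
def cutWeight (S : Finset V) : ℝ := ∑ i ∈ S, ∑ j ∈ Sᶜ, G.weight i j

/-- The Max Cut optimum: the largest fraction of the edge weight that a cut `(S, V - S)` cuts. -/
noncomputable def maxCut : ℝ :=
  (Finset.univ : Finset (Finset V)).sup' ⟨∅, Finset.mem_univ ∅⟩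
    fun S => G.cutWeight S / G.totalWeight

end

/-- `l` lists every edge of `G` exactly once, in any order, with its endpoints in either order. -/
def IsEdgeList {V : Type*} (G : WeightedGraph V) (l : List (V × V)) : Prop :=
  (l.map fun p => s(p.1, p.2)).Nodup ∧
    ∀ e : Sym2 V, e ∈ l.map (fun p => s(p.1, p.2)) ↔ e ∈ G.graph.edgeSet

end WeightedGraph

/-! The randomized real RAM.  The memory consists of finitely many (per program) scalar variables
and unbounded random-access arrays, of two sorts: natural numbers (counters and addresses) and real
numbers.  Natural numbers are only added, subtracted and compared; real numbers are added,
subtracted, multiplied, divided, compared, and have their square roots taken.  There is no rounding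
of reals to integers, and the only numerals are natural numbers.  Every operation, memory access,
test and coin flip costs one step. -/
namespace RealRAM

/-- The memory, and the number of coins flipped so far. -/
structure State where
  nvar : ℕ → ℕ
  narr : ℕ → ℕ → ℕ
  rvar : ℕ → ℝ
  rarr : ℕ → ℕ → ℝ
  coins : ℕ

/-- Expressions of sort natural number; `get a e` is cell number `e` of array `a`. -/
inductive NExp where
  | lit (k : ℕ)
  | var (x : ℕ)
  | get (a : ℕ) (e : NExp)
  | add (e f : NExp)
  | sub (e f : NExp)

/-- Expressions of sort real number. -/
inductive RExp where
  | var (x : ℕ)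
  | get (a : ℕ) (e : NExp)
  | ofNat (e : NExp)
  | add (e f : RExp)
  | sub (e f : RExp)
  | mul (e f : RExp)
  | div (e f : RExp)
  | sqrt (e : RExp)

/-- Tests. -/
inductive BExp where
  | nle (e f : NExp)
  | rle (e f : RExp)
  | not (b : BExp)
  | and (b c : BExp)

/-- Programs. `flip x` stores a fair random bit in the natural number variable `x`. -/
inductive Cmd where
  | skip
  | nset (x : ℕ) (e : NExp)
  | nput (a : ℕ) (i e : NExp)
  | rset (x : ℕ) (e : RExp)
  | rput (a : ℕ) (i : NExp) (e : RExp)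
  | flip (x : ℕ)
  | seq (c d : Cmd)
  | ite (b : BExp) (c d : Cmd)
  | while (b : BExp) (c : Cmd)

/-- The value of an expression (subtraction is truncated). -/
def NExp.eval (s : State) : NExp → ℕ
  | lit k => k
  | var x => s.nvar x
  | get a e => s.narr a (e.eval s)
  | add e f => e.eval s + f.eval s
  | sub e f => e.eval s - f.eval s

/-- The number of steps taken to evaluate an expression. -/
def NExp.cost : NExp → ℕ
  | lit _ => 1
  | var _ => 1
  | get _ e => e.cost + 1
  | add e f => e.cost + f.cost + 1
  | sub e f => e.cost + f.cost + 1

/-- The value of an expression (a quotient by `0` and the root of a negative number are `0`). -/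
noncomputable def RExp.eval (s : State) : RExp → ℝ
  | var x => s.rvar x
  | get a e => s.rarr a (e.eval s)
  | ofNat e => (e.eval s : ℝ)
  | add e f => e.eval s + f.eval s
  | sub e f => e.eval s - f.eval s
  | mul e f => e.eval s * f.eval s
  | div e f => e.eval s / f.eval s
  | sqrt e => Real.sqrt (e.eval s)

/-- The number of steps taken to evaluate an expression. -/
def RExp.cost : RExp → ℕ
  | var _ => 1
  | get _ e => e.cost + 1
  | ofNat e => e.cost + 1
  | add e f => e.cost + f.cost + 1
  | sub e f => e.cost + f.cost + 1
  | mul e f => e.cost + f.cost + 1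
  | div e f => e.cost + f.cost + 1
  | sqrt e => e.cost + 1

/-- The truth of a test. -/
def BExp.Holds (s : State) : BExp → Prop
  | nle e f => e.eval s ≤ f.eval s
  | rle e f => e.eval s ≤ f.eval s
  | not b => ¬ b.Holds s
  | and b c => b.Holds s ∧ c.Holds s

/-- The number of steps taken to evaluate a test. -/
def BExp.cost : BExp → ℕ
  | nle e f => e.cost + f.cost + 1
  | rle e f => e.cost + f.cost + 1
  | not b => b.cost + 1
  | and b c => b.cost + c.cost + 1

/-- `Exec ω c s t s'`: run from state `s` with the coin flips `ω`, the program `c` halts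
after `t` steps in state `s'`. -/
inductive Exec (ω : ℕ → Bool) : Cmd → State → ℕ → State → Prop
  | skip (s : State) : Exec ω .skip s 1 s
  | nset (x : ℕ) (e : NExp) (s : State) :
      Exec ω (.nset x e) s (e.cost + 1)
        { s with nvar := Function.update s.nvar x (e.eval s) }
  | nput (a : ℕ) (i e : NExp) (s : State) :
      Exec ω (.nput a i e) s (i.cost + e.cost + 1)
        { s with narr := Function.update s.narr a
                  (Function.update (s.narr a) (i.eval s) (e.eval s)) }
  | rset (x : ℕ) (e : RExp) (s : State) :
      Exec ω (.rset x e) s (e.cost + 1)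
        { s with rvar := Function.update s.rvar x (e.eval s) }
  | rput (a : ℕ) (i : NExp) (e : RExp) (s : State) :
      Exec ω (.rput a i e) s (i.cost + e.cost + 1)
        { s with rarr := Function.update s.rarr a
                  (Function.update (s.rarr a) (i.eval s) (e.eval s)) }
  | flip (x : ℕ) (s : State) :
      Exec ω (.flip x) s 1
        { s with nvar := Function.update s.nvar x (ω s.coins).toNat, coins := s.coins + 1 }
  | seq {c d : Cmd} {s s' s'' : State} {t u : ℕ} :
      Exec ω c s t s' → Exec ω d s' u s'' → Exec ω (.seq c d) s (t + u) s''
  | ite_true {b : BExp} {c d : Cmd} {s s' : State} {t : ℕ} :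
      b.Holds s → Exec ω c s t s' → Exec ω (.ite b c d) s (b.cost + 1 + t) s'
  | ite_false {b : BExp} {c d : Cmd} {s s' : State} {t : ℕ} :
      ¬ b.Holds s → Exec ω d s t s' → Exec ω (.ite b c d) s (b.cost + 1 + t) s'
  | while_true {b : BExp} {c : Cmd} {s s' s'' : State} {t u : ℕ} :
      b.Holds s → Exec ω c s t s' → Exec ω (.while b c) s' u s'' →
      Exec ω (.while b c) s (b.cost + 1 + t + u) s''
  | while_false {b : BExp} {c : Cmd} {s : State} :
      ¬ b.Holds s → Exec ω (.while b c) s (b.cost + 1) s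

/-- For fixed coin flips, the running time and the final state are determined. -/
theorem Exec.unique {ω : ℕ → Bool} {c : Cmd} {s s₁ s₂ : State} {t₁ t₂ : ℕ}
    (h₁ : Exec ω c s t₁ s₁) (h₂ : Exec ω c s t₂ s₂) : t₁ = t₂ ∧ s₁ = s₂ := by
  induction h₁ generalizing t₂ s₂ with
  | skip | nset | nput | rset | rput | flip => cases h₂; exact ⟨rfl, rfl⟩
  | seq _ _ ih ih' =>
    cases h₂ with
    | seq k k' =>
      obtain ⟨rfl, rfl⟩ := ih k
      obtain ⟨rfl, rfl⟩ := ih' k'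
      exact ⟨rfl, rfl⟩
  | ite_true hb _ ih =>
    cases h₂ with
    | ite_true _ k => obtain ⟨rfl, rfl⟩ := ih k; exact ⟨rfl, rfl⟩
    | ite_false nb _ => exact absurd hb nb
  | ite_false hb _ ih =>
    cases h₂ with
    | ite_true pb _ => exact absurd pb hb
    | ite_false _ k => obtain ⟨rfl, rfl⟩ := ih k; exact ⟨rfl, rfl⟩
  | while_true hb _ _ ih ih' =>
    cases h₂ with
    | while_true _ k k' =>
      obtain ⟨rfl, rfl⟩ := ih k
      obtain ⟨rfl, rfl⟩ := ih' k'
      exact ⟨rfl, rfl⟩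
    | while_false nb => exact absurd hb nb
  | while_false hb =>
    cases h₂ with
    | while_true pb _ _ => exact absurd pb hb
    | while_false _ => exact ⟨rfl, rfl⟩

/-- The law of an infinite sequence of independent fair coin flips. -/
noncomputable def coinMeasure : MeasureTheory.Measure (ℕ → Bool) :=
  MeasureTheory.Measure.infinitePi fun _ => (PMF.uniformOfFintype Bool).toMeasure

/-- The initial state on input `G`, given by the edge list `l`, and `δ`: the natural number
variables `0` and `1` hold the numbers of vertices and edges, the real variable `0` holds `δ`, the
natural number arrays `0` and `1` hold the first and second endpoints of the edges, and the real
array `0` their weights. The rest of the memory is zero. -/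
noncomputable def input {n : ℕ} (G : WeightedGraph (Fin n)) (l : List (Fin n × Fin n)) (δ : ℝ) :
    State where
  nvar x := if x = 0 then n else if x = 1 then l.length else 0
  narr a e :=
    if a = 0 then (l[e]?).elim 0 (fun p => (p.1 : ℕ))
    else if a = 1 then (l[e]?).elim 0 (fun p => (p.2 : ℕ))
    else 0
  rvar x := if x = 0 then δ else 0
  rarr a e := if a = 0 then (l[e]?).elim 0 (fun p => G.weight p.1 p.2) else 0
  coins := 0

/-- The output: the first `n` cells of the real array `1`. -/
def output (n : ℕ) (s : State) : Fin n → ℝ := fun i => s.rarr 1 i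

end RealRAM

/-!
The algorithm is Trevisan's spectral algorithm for Max Cut. Let `A` be the weighted adjacency matrix
and `D` the diagonal matrix of the degrees.

If a cut leaves out at most a fraction `ε` of the weight, its `±1` vector shows that the largest
eigenvalue `lam` of the normalized Laplacian `D ^ (-1/2) (D - A) D ^ (-1/2)` is at least `2 - 2 * ε`
(`WeightedGraph.cutWeight_le`). The power method, with a number of steps of the order of
`log n / δ ^ 2`, finds a vector `D ^ (1/2) x` the Rayleigh quotient of which is at least
`lam - δ ^ 2 / 8` (`LinearMap.IsSymmetric.power_method`, `WeightedGraph.exists_good_direction`). In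
terms of `x` this says that the sum of `A i j * (x i + x j) ^ 2` is at most
`2 * (2 * ε + δ ^ 2 / 8)` times the sum of `d i * x i ^ 2`.

The power method needs an initial vector that is not nearly orthogonal to an eigenvector `v` for
`lam`. The entries of the initial vector are independent and uniform in `{0, 1, 2, 3}`. Changing one
or the other of the two coins for the entry at which `v` is largest moves the inner product with `v`
to two other values, and at most one of the three values is small; as these changes preserve the
probability, the initial vector is bad with probability at most `1/3`
(`RealRAM.two_thirds_le_coinMeasure`).

The rounding takes the vertices in descending order of `|x i|` and puts the first `r` of them on the
side given by the sign of `x i`. If the threshold for `x i ^ 2` is uniform, then the expected volume is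
the sum of `d i * x i ^ 2`, and by the Cauchy-Schwarz inequality the expected cost is small enough
(`WeightedGraph.sum_level_sub_mul_abs_le`, `WeightedGraph.IsSweepCut.uncut_le`). The best `r` is
therefore at least as good. It is found by sorting and one sweep: an edge contributes to the weight
cut by the prefixes of the order from the larger of the ranks of its ends on, so that all these
weights are the partial sums of one array that is filled in a single pass over the edges.

The program is verified with a calculus of total correctness with running times: `RealRAM.Runs` and
the rules `RealRAM.Runs.seq`, `RealRAM.Runs.loop`, `RealRAM.Runs.for`. A loop-free program is
executed symbolically, by `RealRAM.Cmd.den`, and what a program does not touch is read off from its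
text, by `RealRAM.Frame`.
-/

/-! ### Running times and postconditions of programs -/

namespace RealRAM

/-- From `s`, the program `c` halts within `T` steps in a state that satisfies `Q`. -/
def Runs (ω : ℕ → Bool) (c : Cmd) (s : State) (T : ℕ) (Q : State → Prop) : Prop :=
  ∃ t s', Exec ω c s t s' ∧ t ≤ T ∧ Q s'

namespace Cmd

/-- The natural number variable `x` is assigned somewhere in the program. -/
def setsNvar (x : ℕ) : Cmd → Bool
  | nset y _ => x == y
  | flip y => x == y
  | seq c d => c.setsNvar x || d.setsNvar x
  | ite _ c d => c.setsNvar x || d.setsNvar x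
  | .while _ c => c.setsNvar x
  | _ => false

/-- The natural number array `a` is written somewhere in the program. -/
def setsNarr (a : ℕ) : Cmd → Bool
  | nput b _ _ => a == b
  | seq c d => c.setsNarr a || d.setsNarr a
  | ite _ c d => c.setsNarr a || d.setsNarr a
  | .while _ c => c.setsNarr a
  | _ => false

/-- The real variable `x` is assigned somewhere in the program. -/
def setsRvar (x : ℕ) : Cmd → Bool
  | rset y _ => x == y
  | seq c d => c.setsRvar x || d.setsRvar x
  | ite _ c d => c.setsRvar x || d.setsRvar x
  | .while _ c => c.setsRvar x
  | _ => false

/-- The real array `a` is written somewhere in the program. -/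
def setsRarr (a : ℕ) : Cmd → Bool
  | rput b _ _ => a == b
  | seq c d => c.setsRarr a || d.setsRarr a
  | ite _ c d => c.setsRarr a || d.setsRarr a
  | .while _ c => c.setsRarr a
  | _ => false

/-- Somewhere in the program a coin is flipped. -/
def flips : Cmd → Bool
  | flip _ => true
  | seq c d => c.flips || d.flips
  | ite _ c d => c.flips || d.flips
  | .while _ c => c.flips
  | _ => false

/-- The program contains no loop. -/
def loopFree : Cmd → Bool
  | seq c d => c.loopFree && d.loopFree
  | ite _ c d => c.loopFree && d.loopFree
  | .while _ _ => false
  | _ => true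

/-- A bound on the running time of a loop-free program. The value at a loop is irrelevant. -/
def maxCost : Cmd → ℕ
  | skip => 1
  | nset _ e => e.cost + 1
  | nput _ i e => i.cost + e.cost + 1
  | rset _ e => e.cost + 1
  | rput _ i e => i.cost + e.cost + 1
  | flip _ => 1
  | seq c d => c.maxCost + d.maxCost
  | ite b c d => b.cost + 1 + max c.maxCost d.maxCost
  | .while _ _ => 0

open Classical in
/-- The final state of a loop-free program. The value at a loop is irrelevant. -/
noncomputable def den (ω : ℕ → Bool) : Cmd → State → State
  | skip, s => s
  | nset x e, s => { s with nvar := Function.update s.nvar x (e.eval s) }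
  | nput a i e, s =>
    { s with narr := Function.update s.narr a
              (Function.update (s.narr a) (i.eval s) (e.eval s)) }
  | rset x e, s => { s with rvar := Function.update s.rvar x (e.eval s) }
  | rput a i e, s =>
    { s with rarr := Function.update s.rarr a
              (Function.update (s.rarr a) (i.eval s) (e.eval s)) }
  | flip x, s =>
    { s with nvar := Function.update s.nvar x (ω s.coins).toNat, coins := s.coins + 1 }
  | seq c d, s => d.den ω (c.den ω s)
  | ite b c d, s => if b.Holds s then c.den ω s else d.den ω s
  | .while _ _, s => s

end Cmd

/-- The states `s` and `s'` agree on all variables and arrays that `c` does not assign, and on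
the number of coins if `c` flips none. -/
structure Frame (c : Cmd) (s s' : State) : Prop where
  nvar : ∀ x, c.setsNvar x = false → s'.nvar x = s.nvar x
  narr : ∀ a, c.setsNarr a = false → s'.narr a = s.narr a
  rvar : ∀ x, c.setsRvar x = false → s'.rvar x = s.rvar x
  rarr : ∀ a, c.setsRarr a = false → s'.rarr a = s.rarr a
  coins : c.flips = false → s'.coins = s.coins

theorem Frame.refl (c : Cmd) (s : State) : Frame c s s :=
  ⟨fun _ _ => rfl, fun _ _ => rfl, fun _ _ => rfl, fun _ _ => rfl, fun _ => rfl⟩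

theorem Frame.trans {c : Cmd} {s s' s'' : State} (h : Frame c s s') (h' : Frame c s' s'') :
    Frame c s s'' :=
  ⟨fun x hx => (h'.nvar x hx).trans (h.nvar x hx), fun x hx => (h'.narr x hx).trans (h.narr x hx),
    fun x hx => (h'.rvar x hx).trans (h.rvar x hx), fun x hx => (h'.rarr x hx).trans (h.rarr x hx),
    fun hx => (h'.coins hx).trans (h.coins hx)⟩

theorem Exec.frame {ω : ℕ → Bool} {c : Cmd} {s s' : State} {t : ℕ} (h : Exec ω c s t s') :
    Frame c s s' := by
  induction h with
  | skip => exact Frame.refl _ _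
  | nset | nput | rset | rput | flip =>
    refine ⟨fun x hx => ?_, fun x hx => ?_, fun x hx => ?_, fun x hx => ?_, fun hx => ?_⟩ <;>
      first
        | rfl
        | exact Function.update_of_ne (by simpa [Cmd.setsNvar, Cmd.setsNarr, Cmd.setsRvar,
            Cmd.setsRarr] using hx) _ _
        | cases hx
  | seq _ _ ih ih' =>
    refine ⟨fun x hx => ?_, fun x hx => ?_, fun x hx => ?_, fun x hx => ?_, fun hx => ?_⟩ <;>
      simp only [Cmd.setsNvar, Cmd.setsNarr, Cmd.setsRvar, Cmd.setsRarr, Cmd.flips,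
        Bool.or_eq_false_iff] at hx
    · exact (ih'.nvar x hx.2).trans (ih.nvar x hx.1)
    · exact (ih'.narr x hx.2).trans (ih.narr x hx.1)
    · exact (ih'.rvar x hx.2).trans (ih.rvar x hx.1)
    · exact (ih'.rarr x hx.2).trans (ih.rarr x hx.1)
    · exact (ih'.coins hx.2).trans (ih.coins hx.1)
  | ite_true _ _ ih =>
    refine ⟨fun x hx => ?_, fun x hx => ?_, fun x hx => ?_, fun x hx => ?_, fun hx => ?_⟩ <;>
      simp only [Cmd.setsNvar, Cmd.setsNarr, Cmd.setsRvar, Cmd.setsRarr, Cmd.flips,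
        Bool.or_eq_false_iff] at hx
    exacts [ih.nvar x hx.1, ih.narr x hx.1, ih.rvar x hx.1, ih.rarr x hx.1, ih.coins hx.1]
  | ite_false _ _ ih =>
    refine ⟨fun x hx => ?_, fun x hx => ?_, fun x hx => ?_, fun x hx => ?_, fun hx => ?_⟩ <;>
      simp only [Cmd.setsNvar, Cmd.setsNarr, Cmd.setsRvar, Cmd.setsRarr, Cmd.flips,
        Bool.or_eq_false_iff] at hx
    exacts [ih.nvar x hx.2, ih.narr x hx.2, ih.rvar x hx.2, ih.rarr x hx.2, ih.coins hx.2]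
  | while_true _ _ _ ih ih' =>
    exact Frame.trans ⟨ih.nvar, ih.narr, ih.rvar, ih.rarr, ih.coins⟩ ih'
  | while_false => exact Frame.refl _ _

theorem Exec.den {ω : ℕ → Bool} {c : Cmd} (hc : c.loopFree = true) (s : State) :
    ∃ t, Exec ω c s t (c.den ω s) ∧ t ≤ c.maxCost := by
  induction c generalizing s with
  | skip => exact ⟨_, .skip s, le_rfl⟩
  | nset x e => exact ⟨_, .nset x e s, le_rfl⟩
  | nput a i e => exact ⟨_, .nput a i e s, le_rfl⟩
  | rset x e => exact ⟨_, .rset x e s, le_rfl⟩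
  | rput a i e => exact ⟨_, .rput a i e s, le_rfl⟩
  | flip x => exact ⟨_, .flip x s, le_rfl⟩
  | seq c d ih ih' =>
    simp only [Cmd.loopFree, Bool.and_eq_true] at hc
    obtain ⟨t, h, ht⟩ := ih hc.1 s
    obtain ⟨t', h', ht'⟩ := ih' hc.2 (c.den ω s)
    exact ⟨_, .seq h h', add_le_add ht ht'⟩
  | ite b c d ih ih' =>
    simp only [Cmd.loopFree, Bool.and_eq_true] at hc
    by_cases hb : b.Holds s
    · obtain ⟨t, h, ht⟩ := ih hc.1 s
      refine ⟨_, .ite_true hb (s' := (Cmd.ite b c d).den ω s) (t := t) ?_, ?_⟩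
      · simpa [Cmd.den, hb] using h
      · exact Nat.add_le_add_left (ht.trans (le_max_left _ _)) _
    · obtain ⟨t, h, ht⟩ := ih' hc.2 s
      refine ⟨_, .ite_false hb (s' := (Cmd.ite b c d).den ω s) (t := t) ?_, ?_⟩
      · simpa [Cmd.den, hb] using h
      · exact Nat.add_le_add_left (ht.trans (le_max_right _ _)) _
  | _ => simp [Cmd.loopFree] at hc

namespace Runs

variable {ω : ℕ → Bool} {c d : Cmd} {s : State} {T T' : ℕ} {Q Q' : State → Prop}

theorem of_loopFree (hc : c.loopFree = true) (hT : c.maxCost ≤ T) (hQ : Q (c.den ω s)) :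
    Runs ω c s T Q :=
  let ⟨t, h, ht⟩ := Exec.den (ω := ω) hc s
  ⟨t, _, h, ht.trans hT, hQ⟩

theorem mono (h : Runs ω c s T Q) (hT : T ≤ T') (hQ : ∀ s', Frame c s s' → Q s' → Q' s') :
    Runs ω c s T' Q' :=
  let ⟨t, s', h, ht, hs⟩ := h
  ⟨t, s', h, ht.trans hT, hQ s' h.frame hs⟩

theorem seq (h : Runs ω c s T Q) (h' : ∀ s', Frame c s s' → Q s' → Runs ω d s' T' Q') :
    Runs ω (.seq c d) s (T + T') Q' := by
  obtain ⟨t, s', h, ht, hs⟩ := h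
  obtain ⟨t', s'', k, ht', hs'⟩ := h' s' h.frame hs
  exact ⟨_, s'', .seq h k, add_le_add ht ht', hs'⟩

/-- The rule for a loop that makes `N` rounds. The assertion `I k` holds after `k` rounds; it need
not mention what the body of the loop does not change. -/
theorem loop {b : BExp} (I : ℕ → State → Prop) (N T : ℕ) (h0 : I 0 s)
    (step : ∀ k < N, ∀ s', Frame c s s' → I k s' → b.Holds s' ∧ Runs ω c s' T (I (k + 1)))
    (done : ∀ s', Frame c s s' → I N s' → ¬ b.Holds s') :
    Runs ω (.while b c) s (N * (b.cost + 1 + T) + (b.cost + 1)) (I N) := by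
  have key : ∀ r, ∀ k, k + r = N → ∀ s', Frame c s s' → I k s' →
      Runs ω (.while b c) s' (r * (b.cost + 1 + T) + (b.cost + 1)) (I N) := by
    intro r
    induction r with
    | zero =>
      intro k hk s' hF hI
      obtain rfl : k = N := by omega
      exact ⟨_, s', .while_false (done s' hF hI), by omega, hI⟩
    | succ r ih =>
      intro k hk s' hF hI
      obtain ⟨hb, t, s'', hx, ht, hI'⟩ := step k (by omega) s' hF hI
      obtain ⟨t', s₃, hx', ht', hI''⟩ := ih (k + 1) (by omega) s'' (hF.trans hx.frame) hI'
      refine ⟨_, s₃, .while_true hb hx hx', ?_, hI''⟩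
      rw [Nat.succ_mul]
      omega
  exact key N 0 (by omega) s (Frame.refl _ _) h0

end Runs

/-- `for i := 0` up to the value of the natural number variable `y` (exclusive) `do c`, where the
natural number variable `i` is the counter. -/
def Cmd.for (i y : ℕ) (c : Cmd) : Cmd :=
  .seq (.nset i (.lit 0)) (.while (.nle (.add (.var i) (.lit 1)) (.var y))
    (.seq c (.nset i (.add (.var i) (.lit 1)))))

/-- The rule for `for` loops. The assertion `I k` holds after `k` rounds. It must not depend on the
counter `i` (hypothesis `hI`). The command `nset` in the frame of `step` only stands for the
assignments to the counter. -/
theorem Runs.for {ω : ℕ → Bool} {c : Cmd} {s : State} (i y : ℕ) (hiy : y ≠ i)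
    (hi : c.setsNvar i = false) (hy : c.setsNvar y = false)
    (I : ℕ → State → Prop) (T : ℕ)
    (h0 : I 0 s)
    (hI : ∀ k s' x, I k s' → I k { s' with nvar := Function.update s'.nvar i x })
    (step : ∀ k < s.nvar y, ∀ s', Frame (.seq c (.nset i (.lit 0))) s s' → s'.nvar i = k → I k s' →
      Runs ω c s' T (I (k + 1))) :
    Runs ω (Cmd.for i y c) s (s.nvar y * (T + 10) + 8) (I (s.nvar y)) := by
  have hF : ∀ {s'}, Frame (.nset i (.lit 0)) s s' → s'.nvar y = s.nvar y := fun h =>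
    h.nvar y (by simpa [Cmd.setsNvar] using hiy)
  refine (Runs.seq (Q := fun s' => I 0 s' ∧ s'.nvar i = 0) (T := 2)
    (T' := s.nvar y * (T + 10) + 6) ?_ ?_).mono (by omega) fun _ _ h => h
  · refine ⟨_, _, .nset i (.lit 0) s, le_rfl, hI _ _ _ h0, ?_⟩
    simp [NExp.eval]
  · rintro s1 hF1 ⟨hI0, hi0⟩
    have hy1 : s1.nvar y = s.nvar y := hF hF1
    have hfr : ∀ {s'}, Frame (.seq c (.nset i (.add (.var i) (.lit 1)))) s1 s' →
        Frame (.seq c (.nset i (.lit 0))) s s' := by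
      intro s' h
      refine Frame.trans ⟨?_, ?_, ?_, ?_, ?_⟩ ⟨h.nvar, h.narr, h.rvar, h.rarr, h.coins⟩
      · exact fun x hx => hF1.nvar x (by simp_all [Cmd.setsNvar])
      · exact fun x hx => hF1.narr x (by simp_all [Cmd.setsNarr])
      · exact fun x hx => hF1.rvar x (by simp_all [Cmd.setsRvar])
      · exact fun x hx => hF1.rarr x (by simp_all [Cmd.setsRarr])
      · exact fun _ => hF1.coins rfl
    have hys : ∀ {s'}, Frame (.seq c (.nset i (.add (.var i) (.lit 1)))) s1 s' →
        s'.nvar y = s.nvar y := fun h => (h.nvar y (by simp [Cmd.setsNvar, hy, hiy])).trans hy1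
    refine (Runs.loop (fun k s' => I k s' ∧ s'.nvar i = k) (s.nvar y) (T + 4) ⟨hI0, hi0⟩
      ?_ ?_).mono ?_ ?_
    · rintro k hk s' hF' ⟨hIk, hik⟩
      refine ⟨?_, Runs.seq (step k hk s' (hfr hF') hik hIk) (T' := 4) ?_⟩
      · simp only [BExp.Holds, NExp.eval, hik, hys hF']
        omega
      · intro s2 hF2 hI2
        refine ⟨_, _, .nset i _ s2, le_rfl, hI _ _ _ hI2, ?_⟩
        simp [NExp.eval, hF2.nvar i hi, hik]
    · rintro s' hF' ⟨hIk, hik⟩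
      simp only [BExp.Holds, NExp.eval, hik, hys hF']
      omega
    · simp only [BExp.cost, NExp.cost]
      exact Nat.add_le_add (Nat.mul_le_mul_left _ (by omega)) (by omega)
    · exact fun _ _ h => h.1

end RealRAM

/-! ### Loops over arrays, the input and the edge list -/

namespace RealRAM

/-- `a[i] := a[i] + e` for a real array `a`. -/
def Cmd.radd (a : ℕ) (i : NExp) (e : RExp) : Cmd := .rput a i (.add (.get a i) e)

/-- A loop over a list `l` that for each entry `p` adds `F p` to cell number `A p` of an array. -/
theorem Runs.scatter {ω : ℕ → Bool} {s : State} {V : Type*} (l : List V) {y : ℕ}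
    (hl : s.nvar y = l.length) (hy : y ≠ 2) (a : ℕ) (α : NExp) (e : RExp) (A : V → ℕ) (F : V → ℝ)
    (hα : ∀ k (hk : k < l.length) s', Frame (.seq (.radd a α e) (.nset 2 (.lit 0))) s s' →
      s'.nvar 2 = k → α.eval s' = A l[k] ∧ e.eval s' = F l[k]) :
    Runs ω (.for 2 y (.radd a α e)) s (l.length * (2 * α.cost + e.cost + 13) + 8) fun s' =>
      ∀ v, s'.rarr a v = s.rarr a v + (l.map fun p => if A p = v then F p else 0).sum := by
  refine (Runs.for 2 y hy rfl rfl (fun k s' => ∀ v, s'.rarr a v = s.rarr a v +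
      ((l.take k).map fun p => if A p = v then F p else 0).sum) (2 * α.cost + e.cost + 3)
      ?_ ?_ ?_).mono ?_ ?_
  · simp
  · exact fun _ _ _ h => h
  · intro k hk s' hF hi hI
    rw [hl] at hk
    obtain ⟨h1, h2⟩ := hα k hk s' hF hi
    refine Runs.of_loopFree rfl ?_ ?_
    · simp only [Cmd.radd, Cmd.maxCost, RExp.cost]; omega
    · intro v
      rw [List.take_succ_eq_append_getElem hk]
      simp only [Cmd.radd, Cmd.den, RExp.eval, h1, h2, Function.update_self, Function.update_apply,
        List.map_append, List.sum_append, List.map_cons, List.map_nil, List.sum_cons, List.sum_nil,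
        hI]
      by_cases h : v = A l[k]
      · subst h; simp [add_assoc]
      · simp [h, Ne.symm h]
  · rw [hl]
  · intro s' _ h v
    simpa [hl] using h v

/-- A loop that stores `F i` in cell number `i` of an array, for all `i`. -/
theorem Runs.fill {ω : ℕ → Bool} {s : State} {n y : ℕ} (hn : s.nvar y = n) (hy : y ≠ 2) (a : ℕ)
    (e : RExp) (F : Fin n → ℝ)
    (he : ∀ (i : Fin n) s', Frame (.seq (.rput a (.var 2) e) (.nset 2 (.lit 0))) s s' →
      s'.nvar 2 = i → e.eval s' = F i) :
    Runs ω (.for 2 y (.rput a (.var 2) e)) s (n * (e.cost + 12) + 8) fun s' =>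
      ∀ i : Fin n, s'.rarr a i = F i := by
  refine (Runs.for 2 y hy rfl rfl (fun k s' => ∀ i : Fin n, (i : ℕ) < k → s'.rarr a i = F i)
      (e.cost + 2) ?_ ?_ ?_).mono ?_ ?_
  · intro i hi
    omega
  · exact fun _ _ _ h => h
  · intro k hk s' hF hi hI
    rw [hn] at hk
    refine Runs.of_loopFree rfl ?_ ?_
    · simp only [Cmd.maxCost, NExp.cost]; omega
    · intro i hik
      simp only [Cmd.den, NExp.eval, hi, Function.update_self, Function.update_apply]
      split_ifs with h
      · exact he i s' hF (hi.trans h.symm)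
      · exact hI i (by omega)
  · rw [hn]
  · intro s' _ h i
    exact h i (by rw [hn]; exact i.2)

/-- The memory holds the input. -/
structure IsInput {n : ℕ} (G : WeightedGraph (Fin n)) (l : List (Fin n × Fin n)) (δ : ℝ)
    (s : State) : Prop where
  vertices : s.nvar 0 = n
  edges : s.nvar 1 = l.length
  accuracy : s.rvar 0 = δ
  fst : ∀ j (hj : j < l.length), s.narr 0 j = l[j].1
  snd : ∀ j (hj : j < l.length), s.narr 1 j = l[j].2
  weight : ∀ j (hj : j < l.length), s.rarr 0 j = G.weight l[j].1 l[j].2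

/-- The program does not assign the variables and arrays that hold the input. -/
def Cmd.keepsInput (c : Cmd) : Bool :=
  !c.setsNvar 0 && !c.setsNvar 1 && !c.setsRvar 0 && !c.setsNarr 0 && !c.setsNarr 1 &&
    !c.setsRarr 0

variable {n : ℕ} {G : WeightedGraph (Fin n)} {l : List (Fin n × Fin n)} {δ : ℝ} {s s' : State}
  {ω : ℕ → Bool}

theorem IsInput.input : IsInput G l δ (input G l δ) := by
  constructor <;> simp +contextual [RealRAM.input]

theorem IsInput.frame (h : IsInput G l δ s) {c : Cmd} (hF : Frame c s s')
    (hc : c.keepsInput = true) : IsInput G l δ s' := by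
  simp only [Cmd.keepsInput, Bool.and_eq_true, Bool.not_eq_true'] at hc
  obtain ⟨⟨⟨⟨⟨h1, h2⟩, h3⟩, h4⟩, h5⟩, h6⟩ := hc
  constructor
  · rw [hF.nvar 0 h1, h.vertices]
  · rw [hF.nvar 1 h2, h.edges]
  · rw [hF.rvar 0 h3, h.accuracy]
  · rw [hF.narr 0 h4]; exact h.fst
  · rw [hF.narr 1 h5]; exact h.snd
  · rw [hF.rarr 0 h6]; exact h.weight

end RealRAM

namespace WeightedGraph

variable {n : ℕ} (G : WeightedGraph (Fin n))

/-- A sum over the edges, each taken in both directions, is a sum over all ordered pairs. -/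
theorem sum_edgeList {l : List (Fin n × Fin n)} (hl : G.IsEdgeList l) (F : Fin n → Fin n → ℝ)
    (hF : ∀ i j, ¬ G.graph.Adj i j → F i j = 0) :
    (l.map fun p => F p.1 p.2 + F p.2 p.1).sum = ∑ i, ∑ j, F i j := by
  classical
  obtain ⟨hnd, hmem⟩ := hl
  -- The value of an edge, as a function on unordered pairs.
  let H : Sym2 (Fin n) → ℝ := Sym2.lift ⟨fun i j => F i j + F j i, fun i j => add_comm _ _⟩
  have h1 : (l.map fun p => F p.1 p.2 + F p.2 p.1) = (l.map fun p => s(p.1, p.2)).map H := by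
    rw [List.map_map]; rfl
  rw [h1, ← List.sum_toFinset H hnd]
  have h2 : (l.map fun p => s(p.1, p.2)).toFinset = G.graph.edgeFinset := by
    ext e
    rw [List.mem_toFinset, hmem, SimpleGraph.mem_edgeFinset]
  rw [h2]
  have h3 : ∑ i, ∑ j, F i j = ∑ d : G.graph.Dart, F d.fst d.snd := by
    rw [← Finset.sum_product', Finset.univ_product_univ]
    symm
    refine Finset.sum_of_injOn (fun d : G.graph.Dart => d.toProd) ?_ ?_ ?_ ?_
    · intro a _ b _ h; exact SimpleGraph.Dart.ext _ _ h
    · simp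
    · intro p _ hp
      refine hF _ _ fun hadj => hp ⟨⟨p, hadj⟩, by simp, rfl⟩
    · intros; rfl
  rw [h3, ← Finset.sum_fiberwise_of_maps_to (s := Finset.univ) (t := G.graph.edgeFinset)
    (g := fun d : G.graph.Dart => d.edge) (fun d _ => by simp [d.edge_mem])]
  refine Finset.sum_congr rfl fun e he => ?_
  induction e with
  | _ i j =>
    have hadj : G.graph.Adj i j := by simpa using he
    have := (⟨(i, j), hadj⟩ : G.graph.Dart).edge_fiber
    change _ = ∑ d : G.graph.Dart with d.edge = s(i, j), _
    have hd : (⟨(i, j), hadj⟩ : G.graph.Dart).edge = s(i, j) := rfl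
    rw [hd] at this
    rw [this, Finset.sum_pair (SimpleGraph.Dart.symm_ne _).symm]
    rfl

theorem weight_self (i : Fin n) : G.weight i i = 0 := G.weight_eq_zero _ _ G.graph.irrefl

theorem sum_edgeList_fst_add_snd {l : List (Fin n × Fin n)} (hl : G.IsEdgeList l)
    (F : Fin n → Fin n → ℝ) (hF : ∀ i j, ¬ G.graph.Adj i j → F i j = 0) (v : Fin n) :
    (l.map fun p => if p.1 = v then F p.1 p.2 else 0).sum +
      (l.map fun p => if p.2 = v then F p.2 p.1 else 0).sum = ∑ j, F v j := by
  have := G.sum_edgeList hl (fun i j => if i = v then F i j else 0)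
    (fun i j h => by simp [hF i j h])
  rw [← List.sum_map_add, this, Finset.sum_eq_single v] <;> simp +contextual

theorem length_edgeList {l : List (Fin n × Fin n)} (hl : G.IsEdgeList l) :
    G.graph.edgeSet.ncard = l.length := by
  classical
  have h : G.graph.edgeSet = ((l.map fun p => s(p.1, p.2)).toFinset : Set _) := by
    ext e; simp only [List.coe_toFinset, Set.mem_ofPred_eq, hl.2]
  rw [h, Set.ncard_coe_finset, List.toFinset_card_of_nodup hl.1, List.length_map]

end WeightedGraph

/-! ### Degrees, initial vector and power method -/

namespace WeightedGraph

variable {n : ℕ} (G : WeightedGraph (Fin n))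

/-- The diagonal of the matrix `D ^ (-1/2)`, with entry `0` at the vertices of degree `0`. -/
noncomputable def scale (i : Fin n) : ℝ := 1 / √(G.degree i)

/-- The normalized Laplacian `D ^ (-1/2) (D - A) D ^ (-1/2)`, applied to a vector. -/
noncomputable def laplacian (u : Fin n → ℝ) (i : Fin n) : ℝ :=
  G.scale i * G.scale i * G.degree i * u i - ∑ j, G.weight i j * G.scale i * G.scale j * u j

end WeightedGraph

namespace RealRAM

variable {n : ℕ} {G : WeightedGraph (Fin n)} {l : List (Fin n × Fin n)} {δ : ℝ} {s s' : State}
  {ω : ℕ → Bool}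

/-- Computes the degrees, in array 2. -/
def degrees : Cmd :=
  .seq (.for 2 1 (.radd 2 (.get 0 (.var 2)) (.get 0 (.var 2))))
    (.for 2 1 (.radd 2 (.get 1 (.var 2)) (.get 0 (.var 2))))

theorem runs_degrees (h : IsInput G l δ s) (hl : G.IsEdgeList l) (h2 : ∀ i, s.rarr 2 i = 0) :
    Runs ω degrees s (40 * l.length + 16) fun s' => ∀ i : Fin n, s'.rarr 2 i = G.degree i := by
  refine (Runs.seq (Runs.scatter l h.edges (by decide) 2 _ _ (fun p => (p.1 : ℕ))
    (fun p => G.weight p.1 p.2) ?_) fun s1 hF1 h1 => (Runs.scatter l (hF1.nvar 1 rfl ▸ h.edges)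
    (by decide) 2 _ _ (fun p => (p.2 : ℕ)) (fun p => G.weight p.2 p.1) ?_).mono le_rfl ?_).mono ?_
    fun _ _ h => h
  · intro k hk s' hF hi
    have h' := h.frame hF rfl
    simp [NExp.eval, RExp.eval, hi, h'.fst k hk, h'.weight k hk]
  · intro k hk s' hF hi
    have h' := (h.frame hF1 rfl).frame hF rfl
    simp [NExp.eval, RExp.eval, hi, h'.snd k hk, h'.weight k hk, G.weight_symm l[k].2]
  · intro s' hF h' i
    rw [h', h1, h2, zero_add, WeightedGraph.degree]
    simpa only [Fin.val_inj] using
      G.sum_edgeList_fst_add_snd hl G.weight G.weight_eq_zero i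
  · simp only [NExp.cost, RExp.cost]; omega

/-- The random initial vector: every entry is a number in `{0, 1, 2, 3}`, given by two coins. -/
def start (ω : ℕ → Bool) (i : ℕ) : ℝ := (ω (2 * i)).toNat + 2 * (ω (2 * i + 1)).toNat

/-- Computes the scaling factors, in array 3, and flips the coins for the initial vector, in
array 4. -/
def initVectors : Cmd :=
  .for 2 0 (.seq (.rput 3 (.var 2) (.div (.ofNat (.lit 1)) (.sqrt (.get 2 (.var 2)))))
    (.seq (.flip 3) (.seq (.flip 4)
      (.rput 4 (.var 2) (.ofNat (.add (.var 3) (.add (.var 4) (.var 4))))))))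

theorem runs_initVectors (h : IsInput G l δ s) (hc : s.coins = 0)
    (h2 : ∀ i : Fin n, s.rarr 2 i = G.degree i) :
    Runs ω initVectors s (40 * n + 8) fun s' =>
      (∀ i : Fin n, s'.rarr 3 i = G.scale i) ∧ ∀ i : Fin n, s'.rarr 4 i = start ω i := by
  refine (Runs.for 2 0 (by decide) rfl rfl (fun k s' => s'.coins = 2 * k ∧
      (∀ i : Fin n, (i : ℕ) < k → s'.rarr 3 i = G.scale i) ∧
      ∀ i : Fin n, (i : ℕ) < k → s'.rarr 4 i = start ω i) 30 ?_ ?_ ?_).mono ?_ ?_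
  · simp [hc]
  · exact fun _ _ _ h => h
  · rintro k hk s' hF hi ⟨hc', h3, h4⟩
    rw [h.vertices] at hk
    refine Runs.of_loopFree rfl (by decide) ?_
    refine ⟨by simp [Cmd.den, hc']; ring, ?_, ?_⟩
    · intro i hik
      have : s'.rarr 2 i = G.degree i := by rw [hF.rarr 2 rfl, h2]
      by_cases h : (i : ℕ) = k
      · rw [h] at this
        simp [Cmd.den, NExp.eval, RExp.eval, hi, h, this, WeightedGraph.scale]
      · simpa [Cmd.den, NExp.eval, RExp.eval, hi, h] using h3 i (by omega)
    · intro i hik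
      simp only [Cmd.den, NExp.eval, RExp.eval, hi, Function.update_apply, hc']
      by_cases h : (i : ℕ) = k
      · simp [h, start]; ring
      · simpa [h] using h4 i (by omega)
  · rw [h.vertices]; omega
  · rintro s' _ ⟨-, h3, h4⟩
    rw [h.vertices] at h3 h4
    exact ⟨fun i => h3 i i.2, fun i => h4 i i.2⟩

/-- Computes in variable 5 the binary logarithm of `n`, rounded up. -/
def binaryLog : Cmd :=
  .seq (.nset 6 (.lit 1)) (.seq (.nset 5 (.lit 0))
    (.while (.nle (.add (.var 6) (.lit 1)) (.var 0))
      (.seq (.nset 6 (.add (.var 6) (.var 6))) (.nset 5 (.add (.var 5) (.lit 1))))))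

theorem runs_binaryLog (h : IsInput G l δ s) :
    Runs ω binaryLog s (14 * Nat.clog 2 n + 10) fun s' => s'.nvar 5 = Nat.clog 2 n := by
  refine (Runs.seq (Q := fun s' => s'.nvar 6 = 1) (T := 2)
    (Runs.of_loopFree rfl (by decide) (by simp [Cmd.den, NExp.eval])) fun s1 hF1 h1 =>
    Runs.seq (Q := fun s' => s'.nvar 5 = 0) (T := 2)
    (Runs.of_loopFree rfl (by decide) (by simp [Cmd.den, NExp.eval])) fun s2 hF2 h2 =>
    Runs.loop (fun k s' => s'.nvar 6 = 2 ^ k ∧ s'.nvar 5 = k) (Nat.clog 2 n) 8 ?_ ?_ ?_).mono ?_ ?_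
  · exact ⟨by rw [hF2.nvar 6 rfl, h1, pow_zero], h2⟩
  · rintro k hk s' hF ⟨h6, h5⟩
    have h0 := ((h.frame hF1 rfl).frame hF2 rfl).frame hF rfl
    refine ⟨?_, Runs.of_loopFree rfl (by decide) ?_⟩
    · simpa [BExp.Holds, NExp.eval, h6, h0.vertices] using
        (Nat.lt_clog_iff_pow_lt (by decide)).1 hk
    · simp [Cmd.den, NExp.eval, h5, h6, pow_succ]
      ring
  · rintro s' hF ⟨h6, h5⟩
    have h0 := ((h.frame hF1 rfl).frame hF2 rfl).frame hF rfl
    simp [BExp.Holds, NExp.eval, h6, h0.vertices]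
    exact Nat.le_pow_clog (by decide) n
  · simp only [BExp.cost, NExp.cost]; omega
  · exact fun _ _ h => h.2

/-- The weight of an edge, scaled by `D ^ (-1/2)` on both sides, times the entry at the endpoint
listed in the array `b` of the vector in array 4, negated. -/
def edgeTerm (b : ℕ) : RExp :=
  .sub (.ofNat (.lit 0)) (.mul (.mul (.mul (.get 0 (.var 2)) (.get 3 (.get 0 (.var 2))))
    (.get 3 (.get 1 (.var 2)))) (.get 4 (.get b (.var 2))))

/-- Applies the normalized Laplacian to the vector in array 4. -/
def applyLaplacian : Cmd :=
  .seq (.for 2 0 (.rput 5 (.var 2) (.mul (.mul (.mul (.get 3 (.var 2)) (.get 3 (.var 2)))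
      (.get 2 (.var 2))) (.get 4 (.var 2)))))
    (.seq (.for 2 1 (.radd 5 (.get 0 (.var 2)) (edgeTerm 1)))
      (.seq (.for 2 1 (.radd 5 (.get 1 (.var 2)) (edgeTerm 0)))
        (.for 2 0 (.rput 4 (.var 2) (.get 5 (.var 2))))))

theorem runs_applyLaplacian (h : IsInput G l δ s) (hl : G.IsEdgeList l)
    (h2 : ∀ i : Fin n, s.rarr 2 i = G.degree i) (h3 : ∀ i : Fin n, s.rarr 3 i = G.scale i)
    {u : Fin n → ℝ} (h4 : ∀ i : Fin n, s.rarr 4 i = u i) :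
    Runs ω applyLaplacian s (80 * (n + l.length) + 32) fun s' =>
      ∀ i : Fin n, s'.rarr 4 i = G.laplacian u i := by
  refine (Runs.seq (Runs.fill h.vertices (by decide) 5 _
    (fun i => G.scale i * G.scale i * G.degree i * u i) ?_) fun s1 hF1 h1 =>
    Runs.seq (Runs.scatter l (hF1.nvar 1 rfl ▸ h.edges) (by decide) 5 _ _ (fun p => (p.1 : ℕ))
      (fun p => -(G.weight p.1 p.2 * G.scale p.1 * G.scale p.2 * u p.2)) ?_) fun s2 hF2 h2' =>
    Runs.seq (Runs.scatter l ((h.frame hF1 rfl).frame hF2 rfl).edges (by decide) 5 _ _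
      (fun p => (p.2 : ℕ))
      (fun p => -(G.weight p.2 p.1 * G.scale p.2 * G.scale p.1 * u p.1)) ?_) fun s3 hF3 h3' =>
    Runs.fill (((h.frame hF1 rfl).frame hF2 rfl).frame hF3 rfl).vertices (by decide) 4 _
      (G.laplacian u) ?_).mono ?_ ?_
  · intro i s' hF hi
    simp [NExp.eval, RExp.eval, hi, hF.rarr 2 rfl, hF.rarr 3 rfl, hF.rarr 4 rfl, h2, h3, h4]
  · intro k hk s' hF hi
    have h' := (h.frame hF1 rfl).frame hF rfl
    simp [edgeTerm, NExp.eval, RExp.eval, hi, h'.fst k hk, h'.snd k hk, h'.weight k hk,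
      hF.rarr 3 rfl, hF.rarr 4 rfl, hF1.rarr 3 rfl, hF1.rarr 4 rfl, h3, h4]
  · intro k hk s' hF hi
    have h' := ((h.frame hF1 rfl).frame hF2 rfl).frame hF rfl
    simp [edgeTerm, NExp.eval, RExp.eval, hi, h'.fst k hk, h'.snd k hk, h'.weight k hk,
      hF.rarr 3 rfl, hF.rarr 4 rfl, hF1.rarr 3 rfl, hF1.rarr 4 rfl, hF2.rarr 3 rfl,
      hF2.rarr 4 rfl, h3, h4, G.weight_symm l[k].2]
    exact Or.inl (by ring)
  · intro i s' hF hi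
    have := G.sum_edgeList_fst_add_snd hl
      (fun i j => -(G.weight i j * G.scale i * G.scale j * u j))
      (fun i j hij => by simp [G.weight_eq_zero i j hij]) i
    simp only [NExp.eval, RExp.eval, hi, hF.rarr 5 rfl, h3', h2', h1, Fin.val_inj, add_assoc, this]
    rw [WeightedGraph.laplacian, Finset.sum_neg_distrib, sub_eq_add_neg]
  · simp only [edgeTerm, NExp.cost, RExp.cost]; omega
  · exact fun _ _ h => h

/-- The number of steps of the power method. The constant `100` is justified by
`WeightedGraph.log_six_mul_le`. -/
noncomputable def powerSteps (n : ℕ) (δ : ℝ) : ℕ := ⌊100 * (Nat.clog 2 n : ℝ) / δ ^ 2⌋₊ + 1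

/-- The power method: applies the normalized Laplacian repeatedly to the vector in array 4. -/
def powerMethod : Cmd :=
  .while (.rle (.mul (.var 1) (.mul (.var 0) (.var 0))) (.mul (.ofNat (.lit 100)) (.ofNat (.var 5))))
    (.seq applyLaplacian (.rset 1 (.add (.var 1) (.ofNat (.lit 1)))))

theorem runs_powerMethod (h : IsInput G l δ s) (hδ : 0 < δ) (hl : G.IsEdgeList l)
    (hr1 : s.rvar 1 = 0) (h5 : s.nvar 5 = Nat.clog 2 n)
    (h2 : ∀ i : Fin n, s.rarr 2 i = G.degree i) (h3 : ∀ i : Fin n, s.rarr 3 i = G.scale i)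
    {u : Fin n → ℝ} (h4 : ∀ i : Fin n, s.rarr 4 i = u i) :
    Runs ω powerMethod s (powerSteps n δ * (80 * (n + l.length) + 60) + 20) fun s' =>
      ∀ i : Fin n, s'.rarr 4 i = (G.laplacian^[powerSteps n δ] u) i := by
  have hguard : ∀ k s', Frame (.seq applyLaplacian (.rset 1 (.add (.var 1) (.ofNat (.lit 1))))) s s' →
      s'.rvar 1 = (k : ℕ) → ((BExp.rle (.mul (.var 1) (.mul (.var 0) (.var 0)))
        (.mul (.ofNat (.lit 100)) (.ofNat (.var 5)))).Holds s' ↔ k < powerSteps n δ) := by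
    intro k s' hF hr
    have hδ' := (h.frame hF rfl).accuracy
    simp only [BExp.Holds, RExp.eval, NExp.eval, hr, hδ', hF.nvar 5 rfl, h5]
    rw [powerSteps, Nat.lt_succ_iff, Nat.le_floor_iff (by positivity), le_div_iff₀ (by positivity),
      pow_two, Nat.cast_ofNat]
  refine (Runs.loop (fun k s' => s'.rvar 1 = k ∧
    ∀ i : Fin n, s'.rarr 4 i = (G.laplacian^[k] u) i) (powerSteps n δ)
    (80 * (n + l.length) + 37) ⟨by simpa using hr1, h4⟩ ?_ ?_).mono ?_ ?_
  · rintro k hk s' hF ⟨hr, hu⟩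
    refine ⟨(hguard k s' hF hr).2 hk, ?_⟩
    refine (Runs.seq (T' := 5) (runs_applyLaplacian (h.frame hF rfl) hl
      (by rwa [hF.rarr 2 rfl]) (by rwa [hF.rarr 3 rfl]) hu) fun s2 hF2 hu2 =>
      Runs.of_loopFree rfl (by decide) ⟨?_, ?_⟩).mono (by omega) fun _ _ h => h
    · simp [Cmd.den, RExp.eval, NExp.eval, hF2.rvar 1 rfl, hr]
    · intro i
      rw [Function.iterate_succ_apply']
      exact hu2 i
  · rintro s' hF ⟨hr, -⟩
    simpa using (hguard _ s' hF hr).not.2 (lt_irrefl _)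
  · simp only [BExp.cost, RExp.cost, NExp.cost]
    exact Nat.add_le_add (Nat.mul_le_mul_left _ (by omega)) (by omega)
  · exact fun _ _ h => h.2

end RealRAM

/-! ### Merge sort -/

namespace RealRAM

/-- The keys `τ (p 0), …, τ (p (n - 1))` are in descending order within each of the consecutive
blocks of length `w`. -/
def SortedBlocks (τ : ℕ → ℝ) (p : ℕ → ℕ) (n w : ℕ) : Prop :=
  ∀ r r', r ≤ r' → r' < n → r / w = r' / w → τ (p r') ≤ τ (p r)

/-- The situation after `k` elements have been moved from `p` to `q`, while the sorted runs of
length `w` in `p` are merged in pairs. The two current runs are at `[lo, mid)` and `[mid, hi)`,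
and their unmoved parts start at `i` and `j`. That all of `p` is covered is enough to keep track of the
elements: at the end, `q` takes all `n` values of `p` at its `n` cells. -/
structure Merging (τ : ℕ → ℝ) (p q : ℕ → ℕ) (n w k i mid j hi : ℕ) : Prop where
  bounds : i ≤ mid ∧ mid ≤ j ∧ j ≤ hi ∧ hi ≤ n
  moved : i + j = k + mid
  hi_eq : 2 * w ∣ hi ∨ hi = n
  sorted : SortedBlocks τ q k (2 * w)
  covered : ∀ r', r' < i ∨ (mid ≤ r' ∧ r' < j) → ∃ r < k, q r = p r'
  runs : ∃ lo, 2 * w ∣ lo ∧ lo ≤ i ∧ mid ≤ lo + w ∧ hi ≤ lo + 2 * w ∧ (mid = lo + w ∨ mid = hi) ∧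
    ∀ r, lo ≤ r → r < k → (∀ r', i ≤ r' → r' < mid → τ (p r') ≤ τ (q r)) ∧
      ∀ r', j ≤ r' → r' < hi → τ (p r') ≤ τ (q r)

variable {τ : ℕ → ℝ} {p q : ℕ → ℕ} {n w k i mid j hi : ℕ}

theorem Merging.zero : Merging τ p q n w 0 0 0 0 0 where
  bounds := by omega
  moved := rfl
  hi_eq := Or.inl (dvd_zero _)
  sorted := fun _ _ _ h => absurd h (by omega)
  covered := by omega
  runs := ⟨0, dvd_zero _, by omega, by omega, by omega, by omega, by omega⟩

theorem div_eq_div_of_dvd {w lo r r' : ℕ} (h : w ∣ lo) (h1 : lo ≤ r) (h2 : r < lo + w)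
    (h3 : lo ≤ r') (h4 : r' < lo + w) : r / w = r' / w := by
  obtain ⟨c, rfl⟩ := h
  have h5 : ∀ x, w * c ≤ x → x < w * c + w → x / w = c := fun x hx hx' =>
    Nat.div_eq_of_lt_le (by rwa [mul_comm]) (by rwa [Nat.succ_mul, mul_comm c w])
  rw [h5 r h1 h2, h5 r' h3 h4]

theorem le_of_div_eq_div_of_dvd {w lo r r' : ℕ} (hw : 0 < w) (h : w ∣ lo) (h1 : lo ≤ r')
    (h2 : r / w = r' / w) : lo ≤ r := by
  obtain ⟨c, rfl⟩ := h
  have h3 : c ≤ r' / w := (Nat.le_div_iff_mul_le hw).2 (by rwa [mul_comm])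
  rw [mul_comm]
  exact (Nat.le_div_iff_mul_le hw).1 (h2 ▸ h3)

/-- When both runs are used up, the next two runs are taken up. -/
theorem Merging.next (h : Merging τ p q n w k i mid j hi) (hk : hi ≤ k) (hn : k < n) :
    Merging τ p q n w k k (min (k + w) n) (min (k + w) n) (min (k + 2 * w) n) := by
  obtain ⟨h1, h2, h3, h4⟩ := h.bounds
  have h5 := h.moved
  obtain rfl : k = hi := by omega
  have hd : 2 * w ∣ k := h.hi_eq.resolve_right (by omega)
  refine ⟨by omega, rfl, ?_, h.sorted, ?_, k, hd, le_rfl, by omega, by omega, by omega, by omega⟩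
  · rcases le_total (k + 2 * w) n with h6 | h6
    · rw [min_eq_left h6]
      exact Or.inl (hd.add (dvd_refl _))
    · exact Or.inr (min_eq_right h6)
  · intro r' hr'
    exact h.covered r' (by omega)

/-- The general step of the merge: moving an element whose key bounds the remaining ones. -/
theorem Merging.move {i' j' x : ℕ} (h : Merging τ p q n w k i mid j hi) (hw : 0 < w)
    (hi' : (i' = i + 1 ∧ j' = j ∧ x = i ∧ i < mid) ∨ (i' = i ∧ j' = j + 1 ∧ x = j ∧ j < hi))
    (hle : ∀ r', i ≤ r' → r' < mid → τ (p r') ≤ τ (p x))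
    (hle' : ∀ r', j ≤ r' → r' < hi → τ (p r') ≤ τ (p x)) :
    Merging τ p (Function.update q k (p x)) n w (k + 1) i' mid j' hi := by
  obtain ⟨h1, h2, h3, h4⟩ := h.bounds
  have h5 := h.moved
  obtain ⟨lo, hd, hr1, hr2, hr3, hr4, hr5⟩ := h.runs
  have hq : ∀ r, r < k → Function.update q k (p x) r = q r := fun r hr =>
    Function.update_of_ne (by omega) _ _
  refine ⟨by omega, by omega, h.hi_eq, ?_, ?_, lo, hd, by omega, hr2, hr3, hr4, ?_⟩
  · intro r r' hrr' hr' hdiv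
    rcases (Nat.lt_succ_iff.1 hr').lt_or_eq with hr' | rfl
    · rw [hq r' hr', hq r (by omega)]
      exact h.sorted r r' hrr' hr' hdiv
    · rcases hrr'.lt_or_eq with hr | rfl
      · have hlo : lo ≤ r := le_of_div_eq_div_of_dvd (by omega) hd (by omega) hdiv
        rw [Function.update_self, hq r hr]
        rcases hi' with ⟨-, -, rfl, hx⟩ | ⟨-, -, rfl, hx⟩
        · exact (hr5 r hlo hr).1 _ le_rfl hx
        · exact (hr5 r hlo hr).2 _ le_rfl hx
      · exact le_rfl
  · intro r' hr'
    by_cases hrx : r' = x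
    · exact ⟨k, by omega, by rw [Function.update_self, hrx]⟩
    · obtain ⟨r, hr, hqr⟩ := h.covered r' (by omega)
      exact ⟨r, by omega, by rw [hq r hr, hqr]⟩
  · intro r hlo hr
    rcases (Nat.lt_succ_iff.1 hr).lt_or_eq with hr | rfl
    · rw [hq r hr]
      exact ⟨fun r' h6 h7 => (hr5 r hlo hr).1 r' (by omega) h7,
        fun r' h6 h7 => (hr5 r hlo hr).2 r' (by omega) h7⟩
    · rw [Function.update_self]
      exact ⟨fun r' h6 h7 => hle r' (by omega) h7, fun r' h6 h7 => hle' r' (by omega) h7⟩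

theorem Merging.left_le (h : Merging τ p q n w k i mid j hi) (hp : SortedBlocks τ p n w) :
    ∀ r', i ≤ r' → r' < mid → τ (p r') ≤ τ (p i) := by
  intro r' h1 h2
  obtain ⟨h3, h4, h5, h6⟩ := h.bounds
  obtain ⟨lo, hd, hr1, hr2, -⟩ := h.runs
  exact hp i r' h1 (by omega) (div_eq_div_of_dvd (dvd_of_mul_left_dvd hd) hr1 (by omega)
    (by omega) (by omega))

theorem Merging.right_le (h : Merging τ p q n w k i mid j hi) (hp : SortedBlocks τ p n w) :
    ∀ r', j ≤ r' → r' < hi → τ (p r') ≤ τ (p j) := by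
  intro r' h1 h2
  obtain ⟨h3, h4, h5, h6⟩ := h.bounds
  obtain ⟨lo, hd, hr1, hr2, hr3, hr4, -⟩ := h.runs
  refine hp j r' h1 (by omega) (div_eq_div_of_dvd (lo := mid) ?_ h4 (by omega)
    (by omega) (by omega))
  rw [hr4.resolve_right (by omega)]
  exact (dvd_of_mul_left_dvd hd).add (dvd_refl w)

theorem Merging.takeLeft (h : Merging τ p q n w k i mid j hi) (hp : SortedBlocks τ p n w)
    (hw : 0 < w) (hi' : i < mid) (hle : j < hi → τ (p j) ≤ τ (p i)) :
    Merging τ p (Function.update q k (p i)) n w (k + 1) (i + 1) mid j hi :=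
  h.move hw (Or.inl ⟨rfl, rfl, rfl, hi'⟩) (h.left_le hp) fun r' h1 h2 =>
    (h.right_le hp r' h1 h2).trans (hle (by omega))

theorem Merging.takeRight (h : Merging τ p q n w k i mid j hi) (hp : SortedBlocks τ p n w)
    (hw : 0 < w) (hj : j < hi) (hle : i < mid → τ (p i) ≤ τ (p j)) :
    Merging τ p (Function.update q k (p j)) n w (k + 1) i mid (j + 1) hi :=
  h.move hw (Or.inr ⟨rfl, rfl, rfl, hj⟩) (fun r' h1 h2 =>
    (h.left_le hp r' h1 h2).trans (hle (by omega))) (h.right_le hp)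

/-- The minimum of two expressions, by truncated subtraction. -/
def NExp.min (e f : NExp) : NExp := .sub e (.sub e f)

theorem NExp.eval_min (e f : NExp) (s : State) : (e.min f).eval s = Min.min (e.eval s) (f.eval s) := by
  simp only [NExp.min, NExp.eval]
  omega

/-- Takes up the next two runs, which start at the value of variable 2. -/
def nextRuns : Cmd :=
  .seq (.nset 9 (.var 2)) (.seq (.nset 8 (.min (.add (.var 2) (.var 6)) (.var 0)))
    (.seq (.nset 10 (.var 8))
      (.nset 7 (.min (.add (.var 2) (.add (.var 6) (.var 6))) (.var 0)))))

/-- The next element is to be taken from the left run: the right run is used up, or its first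
element does not have a larger key than that of the left run. -/
def leftFirst : BExp :=
  .and (.nle (.add (.var 9) (.lit 1)) (.var 8))
    (.not (.and (.nle (.add (.var 10) (.lit 1)) (.var 7))
      (.not (.rle (.get 6 (.get 2 (.var 10))) (.get 6 (.get 2 (.var 9)))))))

/-- Moves the next element of the merged run from array 2 to array 3. -/
def moveNext : Cmd :=
  .ite leftFirst
    (.seq (.nput 3 (.var 2) (.get 2 (.var 9))) (.nset 9 (.add (.var 9) (.lit 1))))
    (.seq (.nput 3 (.var 2) (.get 2 (.var 10))) (.nset 10 (.add (.var 10) (.lit 1))))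

/-- One pass of merge sort: merges pairs of neighbouring runs, the length of which is in
variable 6, in the natural number array 2. The keys are in the real array 6. -/
def mergePass : Cmd :=
  .seq (.seq (.nset 7 (.lit 0)) (.seq (.nset 8 (.lit 0)) (.seq (.nset 9 (.lit 0)) (.nset 10 (.lit 0)))))
    (.seq (.for 2 0 (.seq (.ite (.nle (.var 7) (.var 2)) nextRuns .skip) moveNext))
      (.for 2 0 (.nput 2 (.var 2) (.get 3 (.var 2)))))

theorem runs_nextRuns {ω : ℕ → Bool} {s : State} (hn : s.nvar 0 = n) (hw : 0 < s.nvar 6)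
    (hk : s.nvar 2 < n)
    (h : Merging (s.rarr 6) (s.narr 2) (s.narr 3) n (s.nvar 6) (s.nvar 2) (s.nvar 9) (s.nvar 8)
      (s.nvar 10) (s.nvar 7)) :
    Runs ω (.ite (.nle (.var 7) (.var 2)) nextRuns .skip) s 40 fun s' =>
      Merging (s'.rarr 6) (s'.narr 2) (s'.narr 3) n (s'.nvar 6) (s'.nvar 2) (s'.nvar 9) (s'.nvar 8)
        (s'.nvar 10) (s'.nvar 7) ∧ s'.nvar 2 < s'.nvar 7 := by
  refine Runs.of_loopFree rfl (by decide) ?_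
  by_cases hhi : s.nvar 7 ≤ s.nvar 2
  · have hnext := h.next hhi hk
    have hlt : s.nvar 2 < min (s.nvar 2 + (s.nvar 6 + s.nvar 6)) n := by omega
    rw [two_mul] at hnext
    simpa [nextRuns, Cmd.den, BExp.Holds, NExp.eval_min, NExp.eval, hhi, hn] using ⟨hnext, by omega⟩
  · simpa [Cmd.den, BExp.Holds, NExp.eval, hhi] using ⟨h, by omega⟩

theorem runs_moveNext {ω : ℕ → Bool} {s : State}
    (hp : SortedBlocks (s.rarr 6) (s.narr 2) n (s.nvar 6)) (hw : 0 < s.nvar 6)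
    (h : Merging (s.rarr 6) (s.narr 2) (s.narr 3) n (s.nvar 6) (s.nvar 2) (s.nvar 9) (s.nvar 8)
      (s.nvar 10) (s.nvar 7)) (hk : s.nvar 2 < s.nvar 7) :
    Runs ω moveNext s 40 fun s' =>
      Merging (s'.rarr 6) (s'.narr 2) (s'.narr 3) n (s'.nvar 6) (s'.nvar 2 + 1) (s'.nvar 9)
        (s'.nvar 8) (s'.nvar 10) (s'.nvar 7) := by
  refine Runs.of_loopFree rfl (by decide) ?_
  by_cases hb : leftFirst.Holds s
  · simp only [moveNext, Cmd.den, hb, if_true]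
    simp only [leftFirst, BExp.Holds, NExp.eval, RExp.eval, not_and, not_not] at hb
    simpa [NExp.eval] using h.takeLeft hp hw hb.1 hb.2
  · have := h.bounds
    have := h.moved
    simp only [moveNext, Cmd.den, hb, if_false]
    simp only [leftFirst, BExp.Holds, NExp.eval, RExp.eval, not_and, not_not] at hb
    have hj : s.nvar 10 < s.nvar 7 := by
      by_contra hj
      exact hb (by omega) fun h' => absurd h' hj
    simpa [NExp.eval] using h.takeRight hp hw hj fun hi' => by
      by_contra hle
      exact hb hi' fun _ => (not_le.1 hle).le

theorem runs_mergePass {ω : ℕ → Bool} {s : State} (hn : s.nvar 0 = n) (hw : 0 < s.nvar 6)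
    (hp : SortedBlocks (s.rarr 6) (s.narr 2) n (s.nvar 6))
    (hs : ∀ v < n, ∃ r < n, s.narr 2 r = v) :
    Runs ω mergePass s (200 * n + 30) fun s' =>
      SortedBlocks (s'.rarr 6) (s'.narr 2) n (2 * s'.nvar 6) ∧ ∀ v < n, ∃ r < n, s'.narr 2 r = v := by
  refine (Runs.seq (T := 8) (Q := fun s' => s'.nvar 7 = 0 ∧ s'.nvar 8 = 0 ∧ s'.nvar 9 = 0 ∧
    s'.nvar 10 = 0) (Runs.of_loopFree rfl (by decide) (by simp [Cmd.den, NExp.eval]))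
    fun s1 hF1 ⟨h7, h8, h9, h10⟩ =>
    Runs.seq (T := n * 90 + 8) (T' := n * 20 + 8) ((Runs.for 2 0 (by decide) rfl rfl
      (fun k s' => Merging (s'.rarr 6) (s'.narr 2) (s'.narr 3) n (s'.nvar 6) k
        (s'.nvar 9) (s'.nvar 8) (s'.nvar 10) (s'.nvar 7)) 80 ?_ ?_ ?_).mono
        (by rw [hF1.nvar 0 rfl, hn]) fun _ _ h => h)
      fun s2 hF2 h2 => (Runs.for 2 0 (by decide) rfl rfl (fun k s' =>
        ∀ r < k, s'.narr 2 r = s2.narr 3 r) 10 ?_ ?_ ?_).mono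
        (by rw [hF2.nvar 0 rfl, hF1.nvar 0 rfl, hn]) ?_).mono (by omega) fun _ _ h => h
  · simpa only [h7, h8, h9, h10] using Merging.zero
  · intro k s' x h
    simpa using h
  · intro k hk s' hF hi hM
    have hn' : s'.nvar 0 = n := by rw [hF.nvar 0 rfl, hF1.nvar 0 rfl, hn]
    have h6 : s'.nvar 6 = s.nvar 6 := by rw [hF.nvar 6 rfl, hF1.nvar 6 rfl]
    have hp' : SortedBlocks (s'.rarr 6) (s'.narr 2) n (s'.nvar 6) := by
      rwa [h6, hF.rarr 6 rfl, hF.narr 2 rfl, hF1.rarr 6 rfl, hF1.narr 2 rfl]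
    rw [hF1.nvar 0 rfl, hn] at hk
    refine Runs.seq (T := 40) (T' := 40) (runs_nextRuns hn' (h6 ▸ hw) (by omega)
      (by rwa [hi])) fun s2 hF2 ⟨hM2, hlt⟩ => ?_
    have h62 : s2.nvar 6 = s.nvar 6 := by rw [hF2.nvar 6 rfl, h6]
    refine (runs_moveNext ?_ (h62 ▸ hw) hM2 hlt).mono le_rfl fun s3 hF3 hM3 => ?_
    · rwa [hF2.rarr 6 rfl, hF2.narr 2 rfl, hF2.nvar 6 rfl]
    · rwa [hF3.nvar 2 rfl, hF2.nvar 2 rfl, hi] at hM3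
  · exact fun r hr => absurd hr (by omega)
  · exact fun _ _ _ h => h
  · intro k hk s' hF hi hI
    refine Runs.of_loopFree rfl (by decide) ?_
    intro r hr
    rcases (Nat.lt_succ_iff.1 hr).lt_or_eq with hr | rfl
    · simpa [Cmd.den, NExp.eval, hi, hr.ne] using hI r hr
    · simp [Cmd.den, NExp.eval, hi, hF.narr 3 rfl]
  · intro s' hF h'
    have hn1 : s1.nvar 0 = n := by rw [hF1.nvar 0 rfl, hn]
    have hn2 : s2.nvar 0 = n := by rw [hF2.nvar 0 rfl, hn1]
    rw [hn2] at h'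
    rw [hn1] at h2
    rw [hF.rarr 6 rfl, hF.nvar 6 rfl]
    refine ⟨fun r r' hr hr' hdiv => ?_, fun v hv => ?_⟩
    · rw [h' r (by omega), h' r' hr']
      exact h2.sorted r r' hr hr' hdiv
    · obtain ⟨r', hr', rfl⟩ := hs v hv
      have hb := h2.bounds
      have hm := h2.moved
      obtain ⟨r, hr, hrr⟩ := h2.covered r' (by omega)
      refine ⟨r, hr, ?_⟩
      rw [h' r hr, hrr, hF2.narr 2 rfl, hF1.narr 2 rfl]

/-- Merge sort of the natural number array 2, with descending keys in the real array 6. -/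
def mergeSort : Cmd :=
  .seq (.nset 6 (.lit 1)) (.while (.nle (.add (.var 6) (.lit 1)) (.var 0))
    (.seq mergePass (.nset 6 (.add (.var 6) (.var 6)))))

theorem runs_mergeSort {ω : ℕ → Bool} {s : State} (hn : s.nvar 0 = n)
    (hs : ∀ v < n, ∃ r < n, s.narr 2 r = v) :
    Runs ω mergeSort s (Nat.clog 2 n * (200 * n + 40) + 8) fun s' =>
      (∀ r r', r ≤ r' → r' < n → s'.rarr 6 (s'.narr 2 r') ≤ s'.rarr 6 (s'.narr 2 r)) ∧
        ∀ v < n, ∃ r < n, s'.narr 2 r = v := by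
  refine (Runs.seq (Q := fun s' => s'.nvar 6 = 1) (T := 2)
    (Runs.of_loopFree rfl (by decide) (by simp [Cmd.den, NExp.eval])) fun s1 hF1 h1 =>
    Runs.loop (fun k s' => s'.nvar 6 = 2 ^ k ∧ SortedBlocks (s'.rarr 6) (s'.narr 2) n (2 ^ k) ∧
      ∀ v < n, ∃ r < n, s'.narr 2 r = v) (Nat.clog 2 n) (200 * n + 34) ?_ ?_ ?_).mono ?_ ?_
  · refine ⟨h1, fun r r' _ _ hdiv => ?_, by rwa [hF1.narr 2 rfl]⟩
    simp only [pow_zero, Nat.div_one] at hdiv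
    rw [hdiv]
  · rintro k hk s' hF ⟨h6, hsort, hsurj⟩
    have hn' : s'.nvar 0 = n := by rw [hF.nvar 0 rfl, hF1.nvar 0 rfl, hn]
    refine ⟨?_, Runs.seq (T' := 4) (runs_mergePass hn' (by rw [h6]; positivity)
      (by rwa [h6]) hsurj) fun s2 hF2 ⟨hsort2, hsurj2⟩ => Runs.of_loopFree rfl (by decide) ?_⟩
    · simpa [BExp.Holds, NExp.eval, h6, hn'] using (Nat.lt_clog_iff_pow_lt (by decide)).1 hk
    · have h62 : s2.nvar 6 = 2 ^ k := by rw [hF2.nvar 6 rfl, h6]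
      rw [h62, ← pow_succ'] at hsort2
      refine ⟨?_, hsort2, hsurj2⟩
      simp [Cmd.den, NExp.eval, h62, pow_succ]
      ring
  · rintro s' hF ⟨h6, -⟩
    have hn' : s'.nvar 0 = n := by rw [hF.nvar 0 rfl, hF1.nvar 0 rfl, hn]
    simpa [BExp.Holds, NExp.eval, h6, hn'] using Nat.le_pow_clog (by decide) n
  · simp only [BExp.cost, NExp.cost]
    rw [← add_assoc, add_comm 2, add_assoc]
    exact Nat.add_le_add (Nat.mul_le_mul_left _ (by omega)) (by omega)
  · rintro s' _ ⟨-, hsort, hsurj⟩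
    refine ⟨fun r r' hr hr' => hsort r r' hr hr' ?_, hsurj⟩
    have := Nat.le_pow_clog (b := 2) (by decide) n
    rw [Nat.div_eq_of_lt (by omega), Nat.div_eq_of_lt (by omega)]

end RealRAM

/-! ### Sweep cuts -/

/-- The sign of a real number, where the sign of `0` is `1`: all signs are `1` or `-1`. -/
noncomputable def signOf (x : ℝ) : ℝ := if 0 ≤ x then 1 else -1

theorem signOf_eq (x : ℝ) : signOf x = 1 ∨ signOf x = -1 := by
  unfold signOf; split_ifs <;> simp

namespace WeightedGraph

variable {n : ℕ} (G : WeightedGraph (Fin n))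

theorem sum_degree_mul (f : Fin n → ℝ) :
    ∑ i, G.degree i * f i = ∑ i, ∑ j, G.weight i j * f i := by
  simp only [degree, Finset.sum_mul]

theorem sum_degree_mul' (f : Fin n → ℝ) :
    ∑ i, G.degree i * f i = ∑ i, ∑ j, G.weight i j * f j := by
  rw [sum_degree_mul, Finset.sum_comm]
  simp only [G.weight_symm]

/-- The weighted number of vertices in the support of a vector with entries in `{-1, 0, 1}`. -/
def volume (y : Fin n → ℝ) : ℝ := ∑ i, G.degree i * |y i|

/-- The cost of a vector with entries in `{-1, 0, 1}`, as a partial cut: every ordered pair of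
neighbours on the same side counts twice, and once if only one of the two has a side. -/
def uncut (y : Fin n → ℝ) : ℝ := ∑ i, ∑ j, G.weight i j * |y i + y j|

/-- The partial cut of the first `r` vertices in the order `σ` by the signs of `x`. -/
noncomputable def prefixCut (σ : Equiv.Perm (Fin n)) (x : Fin n → ℝ) (r : ℕ) (i : Fin n) : ℝ :=
  if (σ i : ℕ) < r then signOf (x i) else 0

/-- Twice the weight of the edges between the first `r` vertices in the order `σ` with ends of
opposite signs. -/
noncomputable def prefixWeight (l : List (Fin n × Fin n)) (σ : Equiv.Perm (Fin n)) (x : Fin n → ℝ)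
    (r : ℕ) : ℝ :=
  (l.map fun p => if max (σ p.1 : ℕ) (σ p.2) < r then
    G.weight p.1 p.2 * (1 - signOf (x p.1) * signOf (x p.2)) else 0).sum

variable {G}

theorem volume_prefixCut (σ : Equiv.Perm (Fin n)) (x : Fin n → ℝ) (r : ℕ) :
    G.volume (prefixCut σ x r) = ∑ i, if (σ i : ℕ) < r then G.degree i else 0 := by
  refine Finset.sum_congr rfl fun i _ => ?_
  unfold prefixCut
  split_ifs
  · rcases signOf_eq (x i) with h | h <;> simp [h]
  · simp

theorem uncut_prefixCut {l : List (Fin n × Fin n)} (hl : G.IsEdgeList l) (σ : Equiv.Perm (Fin n))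
    (x : Fin n → ℝ) (r : ℕ) :
    G.uncut (prefixCut σ x r) = 2 * (G.volume (prefixCut σ x r) - G.prefixWeight l σ x r) := by
  have h1 := G.sum_edgeList hl (fun i j => if max (σ i : ℕ) (σ j) < r then
    G.weight i j * (1 - signOf (x i) * signOf (x j)) / 2 else 0)
    (fun i j h => by simp [G.weight_eq_zero i j h])
  have h2 : G.prefixWeight l σ x r = ∑ i, ∑ j, if max (σ i : ℕ) (σ j) < r then
      G.weight i j * (1 - signOf (x i) * signOf (x j)) / 2 else 0 := by
    rw [← h1, prefixWeight]
    refine congrArg List.sum (List.map_congr_left fun p _ => ?_)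
    rw [max_comm (σ p.2 : ℕ)]
    split_ifs
    · rw [G.weight_symm p.2 p.1]; ring
    · simp
  have h5 : 2 * G.volume (prefixCut σ x r) = ∑ i, ∑ j, G.weight i j *
      (|prefixCut σ x r i| + |prefixCut σ x r j|) := by
    rw [two_mul, volume]
    nth_rw 1 [sum_degree_mul]
    rw [sum_degree_mul']
    simp only [mul_add, Finset.sum_add_distrib]
  rw [mul_sub, h5, h2, uncut, Finset.mul_sum, ← Finset.sum_sub_distrib]
  refine Finset.sum_congr rfl fun i _ => ?_
  rw [Finset.mul_sum, ← Finset.sum_sub_distrib]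
  refine Finset.sum_congr rfl fun j _ => ?_
  unfold prefixCut
  by_cases hi : (σ i : ℕ) < r <;> by_cases hj : (σ j : ℕ) < r <;>
    rcases signOf_eq (x i) with h | h <;> rcases signOf_eq (x j) with h' | h' <;>
    simp [hi, hj, h, h'] <;> norm_num
  all_goals ring

/-- `y` is the best of the partial cuts given by the signs of `x` on the vertices where `|x|` is
largest. The quotients of cost and volume are compared by cross multiplication; nothing is said about
the case that the first vertex in the order has degree `0`. -/
def IsSweepCut (G : WeightedGraph (Fin n)) (x y : Fin n → ℝ) : Prop :=
  ∃ (σ : Equiv.Perm (Fin n)) (b : ℕ), (∀ i j, σ i ≤ σ j → x j ^ 2 ≤ x i ^ 2) ∧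
    y = prefixCut σ x b ∧
    ((∀ r, 1 ≤ r → 0 < G.volume (prefixCut σ x r)) → ∀ r, 1 ≤ r → r ≤ n →
      0 < G.volume y ∧ G.uncut y * G.volume (prefixCut σ x r) ≤
        G.uncut (prefixCut σ x r) * G.volume y)

end WeightedGraph

namespace RealRAM

open WeightedGraph

variable {n : ℕ} {G : WeightedGraph (Fin n)} {l : List (Fin n × Fin n)} {δ : ℝ} {s s' : State}
  {ω : ℕ → Bool}

/-- Computes the squares of the entries of `x = D ^ (-1/2) u`, where `u` is in array 4, and their
signs, in the arrays 6 and 7. The natural number array 2 lists the vertices. -/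
def prepareSort : Cmd :=
  .for 2 0 (.seq (.rput 5 (.var 2) (.mul (.get 3 (.var 2)) (.get 4 (.var 2))))
    (.seq (.rput 6 (.var 2) (.mul (.get 5 (.var 2)) (.get 5 (.var 2))))
    (.seq (.ite (.rle (.ofNat (.lit 0)) (.get 5 (.var 2)))
      (.rput 7 (.var 2) (.ofNat (.lit 1)))
      (.rput 7 (.var 2) (.sub (.ofNat (.lit 0)) (.ofNat (.lit 1)))))
    (.nput 2 (.var 2) (.var 2)))))

theorem runs_prepareSort (h : IsInput G l δ s) {u x : Fin n → ℝ}
    (h3 : ∀ i : Fin n, s.rarr 3 i = G.scale i) (h4 : ∀ i : Fin n, s.rarr 4 i = u i)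
    (hx : ∀ i, x i = G.scale i * u i) :
    Runs ω prepareSort s (50 * n + 8) fun s' => (∀ i : Fin n, s'.rarr 6 i = x i ^ 2) ∧
      (∀ i : Fin n, s'.rarr 7 i = signOf (x i)) ∧ ∀ v < n, ∃ r < n, s'.narr 2 r = v := by
  refine (Runs.for 2 0 (by decide) rfl rfl (fun k s' => ∀ i : Fin n, (i : ℕ) < k →
      s'.rarr 6 i = x i ^ 2 ∧ s'.rarr 7 i = signOf (x i) ∧ s'.narr 2 i = i) 40 ?_ ?_ ?_).mono ?_ ?_
  · exact fun i hi => absurd hi (by omega)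
  · exact fun _ _ _ h => h
  · intro k hk s' hF hi hI
    refine Runs.of_loopFree rfl (by decide) fun i hik => ?_
    by_cases hk : (i : ℕ) = k
    · have hx' : s'.rarr 3 k * s'.rarr 4 k = x i := by
        rw [hF.rarr 3 rfl, hF.rarr 4 rfl, ← hk, h3, h4, hx]
      by_cases h0 : 0 ≤ x i <;>
        simp [Cmd.den, NExp.eval, RExp.eval, BExp.Holds, hi, hk, hx', h0, signOf, pow_two]
    · by_cases h0 : 0 ≤ s'.rarr 3 k * s'.rarr 4 k <;>
        simpa [Cmd.den, NExp.eval, RExp.eval, BExp.Holds, hi, hk, h0] using hI i (by omega)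
  · rw [h.vertices]; omega
  · intro s' _ hI
    rw [h.vertices] at hI
    exact ⟨fun i => (hI i i.2).1, fun i => (hI i i.2).2.1, fun v hv => ⟨v, hv, (hI ⟨v, hv⟩ hv).2.2⟩⟩

/-- Computes the ranks of the vertices in the list in array 2, in the natural number array 4. -/
def ranks : Cmd := .for 2 0 (.nput 4 (.get 2 (.var 2)) (.var 2))

theorem runs_ranks (h : IsInput G l δ s) (hs : ∀ v < n, ∃ r < n, s.narr 2 r = v) :
    Runs ω ranks s (20 * n + 8) fun s' => ∃ σ : Equiv.Perm (Fin n),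
      (∀ i : Fin n, s'.narr 4 i = σ i) ∧ ∀ i : Fin n, s'.narr 2 (σ i) = i := by
  refine (Runs.for 2 0 (by decide) rfl rfl (fun k s' => ∀ v, (∃ r < k, s.narr 2 r = v) →
      s'.narr 4 v < k ∧ s.narr 2 (s'.narr 4 v) = v) 10 ?_ ?_ ?_).mono ?_ ?_
  · rintro v ⟨r, hr, -⟩
    omega
  · exact fun _ _ _ h => h
  · intro k hk s' hF hi hI
    refine Runs.of_loopFree rfl (by decide) ?_
    rintro v ⟨r, hr, hv⟩
    have h2 := hF.narr 2 rfl
    by_cases hkv : v = s.narr 2 k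
    · simp [Cmd.den, NExp.eval, hi, h2, hkv]
    · have hrk : r ≠ k := fun hrk => hkv (by rw [← hv, hrk])
      obtain ⟨h5, h6⟩ := hI v ⟨r, by omega, hv⟩
      simp [Cmd.den, NExp.eval, hi, h2, hkv]
      exact ⟨by omega, h6⟩
  · rw [h.vertices]; omega
  · intro s' hF hI
    rw [h.vertices] at hI
    have hI' : ∀ v : Fin n, s'.narr 4 v < n ∧ s.narr 2 (s'.narr 4 v) = v := fun v => hI v (hs v v.2)
    let g : Fin n → Fin n := fun v => ⟨s'.narr 4 v, (hI' v).1⟩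
    have hg : Function.Injective g := by
      intro v v' hvv
      have h3 : s'.narr 4 v = s'.narr 4 v' := congrArg Fin.val hvv
      apply Fin.ext
      rw [← (hI' v).2, h3, (hI' v').2]
    refine ⟨Equiv.ofBijective g (Finite.injective_iff_bijective.1 hg), fun i => rfl, fun i => ?_⟩
    rw [hF.narr 2 rfl]
    exact (hI' i).2

/-- Adds for every edge twice its weight, if its ends have opposite signs, to the cell of array 8
the number of which is the larger rank of an end. The maximum `max a b` is `a + (b - a)`, with
truncated subtraction. -/
def edgeWeights : Cmd :=
  .for 2 1 (.radd 8 (.add (.get 4 (.get 0 (.var 2))) (.sub (.get 4 (.get 1 (.var 2)))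
      (.get 4 (.get 0 (.var 2)))))
    (.mul (.get 0 (.var 2)) (.sub (.ofNat (.lit 1))
      (.mul (.get 7 (.get 0 (.var 2))) (.get 7 (.get 1 (.var 2)))))))

theorem runs_edgeWeights (h : IsInput G l δ s) {x : Fin n → ℝ}
    (h7 : ∀ i : Fin n, s.rarr 7 i = signOf (x i)) (h8 : ∀ v, s.rarr 8 v = 0)
    {σ : Equiv.Perm (Fin n)} (hσ : ∀ i : Fin n, s.narr 4 i = σ i) :
    Runs ω edgeWeights s (60 * l.length + 8) fun s' => ∀ k,
      s'.rarr 8 k = G.prefixWeight l σ x (k + 1) - G.prefixWeight l σ x k := by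
  refine (Runs.scatter l h.edges (by decide) 8 _ _ (fun p => max (σ p.1 : ℕ) (σ p.2))
    (fun p => G.weight p.1 p.2 * (1 - signOf (x p.1) * signOf (x p.2))) ?_).mono ?_ ?_
  · intro k hk s' hF hi
    have h' := h.frame hF rfl
    have h4 := hF.narr 4 rfl
    have h7' := hF.rarr 7 rfl
    simp [NExp.eval, RExp.eval, hi, h'.fst k hk, h'.snd k hk, h'.weight k hk, h4, h7', hσ, h7]
    omega
  · simp only [NExp.cost, RExp.cost]; omega
  · intro s' _ hI k
    rw [hI, h8, zero_add, eq_sub_iff_add_eq, prefixWeight, prefixWeight, ← List.sum_map_add]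
    refine congrArg List.sum (List.map_congr_left fun p _ => ?_)
    simp only [Nat.lt_succ_iff]
    rcases lt_trichotomy (max (σ p.1 : ℕ) (σ p.2)) k with hk | hk | hk
    · rw [if_neg hk.ne, if_pos hk, if_pos hk.le, zero_add]
    · rw [if_pos hk, if_neg hk.not_lt, if_pos hk.le, add_zero]
    · rw [if_neg hk.ne', if_neg hk.not_gt, if_neg hk.not_ge, add_zero]

/-- Finds the best prefix of the list of the vertices: variable 11 receives its length. The real
variables 2 and 3 hold the volume of the current prefix and the value of `prefixWeight` for it, and
the real variables 4 and 5 those of the best prefix so far, at first the empty one. By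
`WeightedGraph.uncut_prefixCut`, the best prefix is the one with the largest `prefixWeight` relative
to its volume. -/
def sweep : Cmd :=
  .for 2 0 (.seq (.rset 2 (.add (.var 2) (.get 2 (.get 2 (.var 2)))))
    (.seq (.rset 3 (.add (.var 3) (.get 8 (.var 2))))
      (.ite (.rle (.mul (.var 5) (.var 2)) (.mul (.var 3) (.var 4)))
        (.seq (.nset 11 (.add (.var 2) (.lit 1))) (.seq (.rset 4 (.var 2)) (.rset 5 (.var 3))))
        .skip)))

theorem volume_prefixCut_succ (σ : Equiv.Perm (Fin n)) (x : Fin n → ℝ) (k : Fin n) :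
    G.volume (prefixCut σ x (k + 1)) = G.volume (prefixCut σ x k) + G.degree (σ.symm k) := by
  have h : G.degree (σ.symm k) = ∑ i, if i = σ.symm k then G.degree i else 0 := by simp
  rw [volume_prefixCut, volume_prefixCut, h, ← Finset.sum_add_distrib]
  refine Finset.sum_congr rfl fun i _ => ?_
  simp only [Equiv.eq_symm_apply, Fin.ext_iff, Nat.lt_succ_iff]
  rcases lt_trichotomy (σ i : ℕ) k with hk | hk | hk
  · rw [if_pos hk.le, if_pos hk, if_neg hk.ne, add_zero]
  · rw [if_pos hk.le, if_neg hk.not_lt, if_pos hk, zero_add]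
  · rw [if_neg hk.not_ge, if_neg hk.not_gt, if_neg hk.ne', add_zero]

theorem runs_sweep (h : IsInput G l δ s) (hl : G.IsEdgeList l) {x : Fin n → ℝ}
    {σ : Equiv.Perm (Fin n)} (h2 : ∀ i : Fin n, s.rarr 2 i = G.degree i)
    (hσ : ∀ i : Fin n, s.narr 2 (σ i) = i)
    (h8 : ∀ k, s.rarr 8 k = G.prefixWeight l σ x (k + 1) - G.prefixWeight l σ x k)
    (hr2 : s.rvar 2 = 0) (hr3 : s.rvar 3 = 0) (hr4 : s.rvar 4 = 0) (hr5 : s.rvar 5 = 0)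
    (h11 : s.nvar 11 = 0) :
    Runs ω sweep s (50 * n + 8) fun s' =>
      (∀ r, 1 ≤ r → 0 < G.volume (prefixCut σ x r)) → ∀ r, 1 ≤ r → r ≤ n →
        0 < G.volume (prefixCut σ x (s'.nvar 11)) ∧
        G.uncut (prefixCut σ x (s'.nvar 11)) * G.volume (prefixCut σ x r) ≤
        G.uncut (prefixCut σ x r) * G.volume (prefixCut σ x (s'.nvar 11)) := by
  set V : ℕ → ℝ := fun r => G.volume (prefixCut σ x r) with hV
  set W : ℕ → ℝ := fun r => G.prefixWeight l σ x r with hW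
  have hV0 : V 0 = 0 := by simp [hV, volume_prefixCut]
  have hW0 : W 0 = 0 := by simp [hW, prefixWeight]
  refine (Runs.for 2 0 (by decide) rfl rfl (fun k s' => s'.rvar 2 = V k ∧ s'.rvar 3 = W k ∧
    s'.nvar 11 ≤ k ∧ s'.rvar 4 = V (s'.nvar 11) ∧ s'.rvar 5 = W (s'.nvar 11) ∧
    ((∀ r, 1 ≤ r → 0 < V r) → ∀ r, 1 ≤ r → r ≤ k → 0 < V (s'.nvar 11) ∧
      W r * V (s'.nvar 11) ≤ W (s'.nvar 11) * V r)) 40 ?_ ?_ ?_).mono ?_ ?_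
  · rw [hr2, hr3, hr4, hr5, h11, hV0, hW0]
    exact ⟨rfl, rfl, le_rfl, rfl, rfl, fun _ r h1 h2 => absurd h1 (by omega)⟩
  · intro k s' y h
    simpa using h
  · rintro k hk s' hF hi ⟨i2, i3, hb, i4, i5, hI⟩
    rw [h.vertices] at hk
    refine Runs.of_loopFree rfl (by decide) ?_
    have e2 : s'.rvar 2 + s'.rarr 2 (s'.narr 2 k) = V (k + 1) := by
      have := volume_prefixCut_succ (G := G) σ x ⟨k, hk⟩
      have h' := hσ (σ.symm ⟨k, hk⟩)
      rw [Equiv.apply_symm_apply] at h'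
      rw [hF.rarr 2 rfl, hF.narr 2 rfl, h', h2, i2, hV]
      exact this.symm
    have e3 : s'.rvar 3 + s'.rarr 8 k = W (k + 1) := by
      rw [hF.rarr 8 rfl, h8, i3, hW]
      ring
    by_cases hle : W (s'.nvar 11) * V (k + 1) ≤ W (k + 1) * V (s'.nvar 11)
    · simp only [Cmd.den, NExp.eval, RExp.eval, BExp.Holds, hi]
      simp [e2, e3, i4, i5, hle]
      intro hpos r h1 h3
      refine ⟨hpos (k + 1) (by omega), ?_⟩
      rcases h3.lt_or_eq with h3 | rfl
      · obtain ⟨hb0, hb1⟩ := hI hpos r h1 (by omega)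
        refine le_of_mul_le_mul_right ?_ hb0
        nlinarith [mul_le_mul_of_nonneg_right hb1 (hpos (k + 1) (by omega)).le,
          mul_le_mul_of_nonneg_right hle (hpos r h1).le]
      · exact le_rfl
    · simp only [Cmd.den, NExp.eval, RExp.eval, BExp.Holds, hi]
      simp [e2, e3, i4, i5, hle]
      refine ⟨by omega, fun hpos r h1 h3 => ?_⟩
      have hk0 : 1 ≤ k := by
        by_contra hk0
        have hb0 : s'.nvar 11 = 0 := by omega
        rw [hb0, hV0, hW0] at hle
        simp at hle
      refine ⟨(hI hpos 1 le_rfl hk0).1, ?_⟩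
      rcases h3.lt_or_eq with h3 | rfl
      · exact (hI hpos r h1 (by omega)).2
      · exact (not_le.1 hle).le
  · rw [h.vertices]; omega
  · rintro s' _ ⟨-, -, -, -, -, hI⟩ hpos r h1 h3
    rw [h.vertices] at hI
    obtain ⟨hb0, hb1⟩ := hI hpos r h1 h3
    refine ⟨hb0, ?_⟩
    rw [uncut_prefixCut hl, uncut_prefixCut hl]
    simp only [hV, hW] at hb1
    linarith

/-- Stores the partial cut found by `sweep` in array 1. -/
def writeOutput : Cmd :=
  .for 2 0 (.ite (.nle (.add (.get 4 (.var 2)) (.lit 1)) (.var 11))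
    (.rput 1 (.var 2) (.get 7 (.var 2))) (.rput 1 (.var 2) (.ofNat (.lit 0))))

theorem runs_writeOutput (h : IsInput G l δ s) {x : Fin n → ℝ}
    (h7 : ∀ i : Fin n, s.rarr 7 i = signOf (x i))
    {σ : Equiv.Perm (Fin n)} (hσ : ∀ i : Fin n, s.narr 4 i = σ i) :
    Runs ω writeOutput s (30 * n + 8) fun s' => output n s' = prefixCut σ x (s.nvar 11) := by
  refine (Runs.for 2 0 (by decide) rfl rfl (fun k s' => ∀ i : Fin n, (i : ℕ) < k →
    s'.rarr 1 i = prefixCut σ x (s.nvar 11) i) 20 ?_ ?_ ?_).mono ?_ ?_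
  · exact fun i hi => absurd hi (by omega)
  · exact fun _ _ _ h => h
  · intro k hk s' hF hi hI
    refine Runs.of_loopFree rfl (by decide) fun i hik => ?_
    by_cases hk : (i : ℕ) = k
    · have h4' : s'.narr 4 k = σ i := by rw [hF.narr 4 rfl, ← hk, hσ]
      have h7' : s'.rarr 7 k = signOf (x i) := by rw [hF.rarr 7 rfl, ← hk, h7]
      by_cases h0 : (σ i : ℕ) < s.nvar 11 <;>
        simp [Cmd.den, NExp.eval, RExp.eval, BExp.Holds, hi, hk, h4', h7', hF.nvar 11 rfl,
          prefixCut, h0]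
    · by_cases h0 : s'.narr 4 k < s'.nvar 11 <;>
        simpa [Cmd.den, NExp.eval, RExp.eval, BExp.Holds, hi, hk, h0] using hI i (by omega)
  · rw [h.vertices]; omega
  · intro s' _ hI
    rw [h.vertices] at hI
    exact funext fun i => hI i i.2

end RealRAM

/-! ### The algorithm -/

namespace RealRAM

open WeightedGraph

variable {n : ℕ} {G : WeightedGraph (Fin n)} {l : List (Fin n × Fin n)} {δ : ℝ} {ω : ℕ → Bool}

/-- The algorithm: the power method for the normalized Laplacian from a random vector, followed by
a sweep over the vertices in the order of the absolute values of the resulting vector.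

Apart from the input, the memory is used as follows. Natural number variables: 2 loop counter, 3 and
4 coins, 5 binary logarithm of `n`, 6 to 10 merge sort, 11 length of the best prefix. Natural number
arrays: 2 vertices in the current order, 3 output of a merge pass, 4 ranks. Real variables: 1 steps
of the power method, 2 to 5 sweep. Real arrays: 1 output, 2 degrees, 3 scaling factors, 4 vector of
the power method, 5 auxiliary vector, 6 keys for sorting, 7 signs, 8 weights for the sweep. -/
def spectralCut : Cmd :=
  .seq degrees (.seq initVectors (.seq binaryLog (.seq powerMethod (.seq prepareSort
    (.seq mergeSort (.seq ranks (.seq edgeWeights (.seq sweep writeOutput))))))))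

/-- The vector that the power method produces, scaled by `D ^ (-1/2)`. -/
noncomputable def powerVector (G : WeightedGraph (Fin n)) (δ : ℝ) (ω : ℕ → Bool) (i : Fin n) : ℝ :=
  G.scale i * (G.laplacian^[powerSteps n δ] fun i => start ω i) i

theorem runs_spectralCut (hl : G.IsEdgeList l) (hδ : 0 < δ) :
    Runs ω spectralCut (input G l δ) (powerSteps n δ * (80 * (n + l.length) + 60) +
      Nat.clog 2 n * (200 * n + 54) + 300 * (n + l.length) + 200) fun s =>
        G.IsSweepCut (powerVector G δ ω) (output n s) := by
  have h : IsInput G l δ (input G l δ) := IsInput.input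
  refine Runs.mono (
    Runs.seq (runs_degrees h hl (by simp [input])) fun s1 f1 d1 =>
    Runs.seq (runs_initVectors (h.frame f1 rfl) (by rw [f1.coins rfl]; rfl) d1)
      fun s2 f2 ⟨sc2, u2⟩ =>
    Runs.seq (runs_binaryLog ((h.frame f1 rfl).frame f2 rfl)) fun s3 f3 L3 =>
    have h3 := ((h.frame f1 rfl).frame f2 rfl).frame f3 rfl
    have d3 : ∀ i : Fin n, s3.rarr 2 i = G.degree i := by rwa [f3.rarr 2 rfl, f2.rarr 2 rfl]
    have sc3 : ∀ i : Fin n, s3.rarr 3 i = G.scale i := by rwa [f3.rarr 3 rfl]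
    Runs.seq (runs_powerMethod h3 hδ hl
      (by rw [f3.rvar 1 rfl, f2.rvar 1 rfl, f1.rvar 1 rfl]; rfl) L3 d3 sc3
      (by rwa [f3.rarr 4 rfl])) fun s4 f4 u4 =>
    Runs.seq (runs_prepareSort (h3.frame f4 rfl) (by rwa [f4.rarr 3 rfl]) u4
      (x := powerVector G δ ω) fun _ => rfl) fun s5 f5 ⟨key5, sg5, p5⟩ =>
    have h5 := (h3.frame f4 rfl).frame f5 rfl
    Runs.seq (runs_mergeSort h5.vertices p5) fun s6 f6 ⟨sort6, p6⟩ =>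
    Runs.seq (runs_ranks (h5.frame f6 rfl) p6) fun s7 f7 ⟨σ, rank7, p7⟩ =>
    have h7 := (h5.frame f6 rfl).frame f7 rfl
    have sg7 : ∀ i : Fin n, s7.rarr 7 i = signOf (powerVector G δ ω i) := by
      rwa [f7.rarr 7 rfl, f6.rarr 7 rfl]
    Runs.seq (runs_edgeWeights (x := powerVector G δ ω) h7 sg7 (by
      rw [f7.rarr 8 rfl, f6.rarr 8 rfl, f5.rarr 8 rfl, f4.rarr 8 rfl, f3.rarr 8 rfl, f2.rarr 8 rfl,
        f1.rarr 8 rfl]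
      simp [input]) rank7) fun s8 f8 w8 =>
    have h8 := h7.frame f8 rfl
    Runs.seq (runs_sweep (x := powerVector G δ ω) (σ := σ) h8 hl
      (by rwa [f8.rarr 2 rfl, f7.rarr 2 rfl, f6.rarr 2 rfl, f5.rarr 2 rfl, f4.rarr 2 rfl])
      (by rwa [f8.narr 2 rfl]) w8
      (by rw [f8.rvar 2 rfl, f7.rvar 2 rfl, f6.rvar 2 rfl, f5.rvar 2 rfl, f4.rvar 2 rfl,
        f3.rvar 2 rfl, f2.rvar 2 rfl, f1.rvar 2 rfl]; rfl)
      (by rw [f8.rvar 3 rfl, f7.rvar 3 rfl, f6.rvar 3 rfl, f5.rvar 3 rfl, f4.rvar 3 rfl,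
        f3.rvar 3 rfl, f2.rvar 3 rfl, f1.rvar 3 rfl]; rfl)
      (by rw [f8.rvar 4 rfl, f7.rvar 4 rfl, f6.rvar 4 rfl, f5.rvar 4 rfl, f4.rvar 4 rfl,
        f3.rvar 4 rfl, f2.rvar 4 rfl, f1.rvar 4 rfl]; rfl)
      (by rw [f8.rvar 5 rfl, f7.rvar 5 rfl, f6.rvar 5 rfl, f5.rvar 5 rfl, f4.rvar 5 rfl,
        f3.rvar 5 rfl, f2.rvar 5 rfl, f1.rvar 5 rfl]; rfl)
      (by rw [f8.nvar 11 rfl, f7.nvar 11 rfl, f6.nvar 11 rfl, f5.nvar 11 rfl, f4.nvar 11 rfl,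
        f3.nvar 11 rfl, f2.nvar 11 rfl, f1.nvar 11 rfl]; rfl)) fun s9 f9 best9 =>
    (runs_writeOutput (x := powerVector G δ ω) (σ := σ) (h8.frame f9 rfl)
      (by rwa [f9.rarr 7 rfl, f8.rarr 7 rfl]) (by rwa [f9.narr 4 rfl, f8.narr 4 rfl])).mono
      le_rfl fun s10 f10 out => ?_) ?_ fun _ _ h => h
  · refine ⟨σ, s9.nvar 11, fun i j hij => ?_, out, out ▸ best9⟩
    have hs := sort6 (σ i) (σ j) hij (σ j).2
    have hp : s7.narr 2 = s6.narr 2 := f7.narr 2 rfl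
    rwa [← hp, p7, p7, f6.rarr 6 rfl, key5, key5] at hs
  · ring_nf
    omega

end RealRAM

/-! ### The power method for a positive semidefinite operator -/

section PowerMethod

open scoped RealInnerProductSpace

variable {E : Type*} [NormedAddCommGroup E] [InnerProductSpace ℝ E]

/-- The Cauchy-Schwarz inequality for a positive semidefinite operator. -/
theorem LinearMap.IsSymmetric.inner_sq_le {T : E →ₗ[ℝ] E} (hT : T.IsSymmetric)
    (hpos : ∀ x, 0 ≤ ⟪T x, x⟫) (x y : E) : ⟪T x, y⟫ ^ 2 ≤ ⟪T x, x⟫ * ⟪T y, y⟫ := by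
  have h : ∀ t : ℝ, 0 ≤ ⟪T y, y⟫ * (t * t) + (2 * ⟪T x, y⟫) * t + ⟪T x, x⟫ := by
    intro t
    have h1 := hpos (x + t • y)
    have h2 : ⟪T y, x⟫ = ⟪T x, y⟫ := by rw [hT, real_inner_comm]
    simp only [map_add, map_smul, inner_add_left, inner_add_right, real_inner_smul_left,
      real_inner_smul_right, h2] at h1
    linarith
  have := discrim_le_zero h
  rw [discrim] at this
  linarith

/-- The analysis of the power method. As the moments `⟪T ^ j u, u⟫` have increasing ratios, their
ratio at `2 * k` is at least the geometric mean of the earlier ratios, while the moment at `2 * k`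
is at least `lam ^ (2 * k) * ⟪v, u⟫ ^ 2`. -/
theorem LinearMap.IsSymmetric.power_method {T : E →ₗ[ℝ] E} (hT : T.IsSymmetric)
    (hpos : ∀ x, 0 ≤ ⟪T x, x⟫) {v u : E} {lam c : ℝ} (hlam : 0 < lam) (hv : ‖v‖ = 1)
    (hTv : T v = lam • v) (hc : 0 < c) (hu : u ≠ 0) (hvu : c * ‖u‖ ^ 2 ≤ ⟪v, u⟫ ^ 2)
    {k : ℕ} (hk : 0 < k) :
    0 < ‖(T ^ k) u‖ ∧
    lam * (1 - Real.log c⁻¹ / (2 * k)) * ‖(T ^ k) u‖ ^ 2 ≤ ⟪T ((T ^ k) u), (T ^ k) u⟫ := by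
  have hshift : ∀ i j, ⟪(T ^ (i + j)) u, u⟫ = ⟪(T ^ i) u, (T ^ j) u⟫ := by
    intro i j
    induction j generalizing i with
    | zero => simp
    | succ j ih =>
      rw [← add_assoc, add_right_comm, ih, pow_succ', pow_succ', Module.End.mul_apply,
        Module.End.mul_apply, hT]
  set m : ℕ → ℝ := fun j => ⟪(T ^ j) u, u⟫ with hm
  have hu2 : 0 < ‖u‖ ^ 2 := by positivity
  have hvu' : 0 < ⟪v, u⟫ ^ 2 := (mul_pos hc hu2).trans_le hvu
  have hvT : ∀ j, ⟪v, (T ^ j) u⟫ = lam ^ j * ⟪v, u⟫ := by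
    intro j
    induction j with
    | zero => simp
    | succ j ih =>
      rw [pow_succ', Module.End.mul_apply, ← hT, hTv, real_inner_smul_left, ih, pow_succ']
      ring
  have heven : ∀ j, m (2 * j) = ‖(T ^ j) u‖ ^ 2 := fun j => by
    rw [hm, ← real_inner_self_eq_norm_sq, ← hshift, two_mul]
  have hlow : ∀ j, lam ^ (2 * j) * ⟪v, u⟫ ^ 2 ≤ m (2 * j) := by
    intro j
    rw [heven, mul_comm 2 j, pow_mul, ← mul_pow, ← hvT, ← sq_abs]
    refine pow_le_pow_left₀ (abs_nonneg _) ?_ 2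
    simpa [hv] using abs_real_inner_le_norm v ((T ^ j) u)
  have hodd : ∀ j, m (2 * j + 1) = ⟪T ((T ^ j) u), (T ^ j) u⟫ := fun j => by
    rw [hm, two_mul, add_right_comm]
    simp only [hshift, pow_succ', Module.End.mul_apply]
  have hconv : ∀ j, m (j + 1) ^ 2 ≤ m j * m (j + 2) := by
    intro j
    obtain ⟨i, rfl | rfl⟩ := Nat.even_or_odd' j
    · have h1 : m (2 * i + 1) = ⟪(T ^ (i + 1)) u, (T ^ i) u⟫ := by
        simp only [hm, ← hshift]; ring_nf
      rw [h1, heven, show 2 * i + 2 = 2 * (i + 1) by ring, heven, ← mul_pow, ← sq_abs, mul_comm]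
      exact pow_le_pow_left₀ (abs_nonneg _) (abs_real_inner_le_norm _ _) 2
    · have h1 : m (2 * i + 1 + 1) = ⟪T ((T ^ i) u), (T ^ (i + 1)) u⟫ := by
        rw [← Module.End.mul_apply, ← pow_succ']
        simp only [hm, ← hshift]; ring_nf
      rw [h1, hodd, show 2 * i + 1 + 2 = 2 * (i + 1) + 1 by ring, hodd]
      exact hT.inner_sq_le hpos _ _
  have hmpos : ∀ j, 0 < m j := by
    have he : ∀ i, 0 < m (2 * i) := fun i => (by positivity : (0 : ℝ) < _).trans_le (hlow i)
    intro j
    obtain ⟨i, rfl | rfl⟩ := Nat.even_or_odd' j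
    · exact he i
    · have h1 := hconv (2 * i + 1)
      have h2 : 0 < m (2 * i + 1 + 1) := he (i + 1)
      have h3 : 0 ≤ m (2 * i + 1) := by rw [hodd]; exact hpos _
      refine h3.lt_of_ne' fun h0 => ?_
      rw [h0, zero_mul] at h1
      exact absurd h1 (not_le.2 (by positivity))
  have hmono : Monotone fun j => m (j + 1) / m j := by
    refine monotone_nat_of_le_succ fun j => ?_
    rw [div_le_div_iff₀ (hmpos _) (hmpos _), ← pow_two]
    linarith [hconv j]
  set ρ := m (2 * k + 1) / m (2 * k) with hρ
  have hρ0 : 0 < ρ := div_pos (hmpos _) (hmpos _)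
  have hup : ∀ j ≤ 2 * k, m j ≤ ρ ^ j * ‖u‖ ^ 2 := by
    intro j hj
    induction j with
    | zero => simp [hm]
    | succ j ih =>
      have h1 : m (j + 1) / m j ≤ ρ := hmono (by omega : j ≤ 2 * k)
      rw [div_le_iff₀ (hmpos j)] at h1
      calc m (j + 1) ≤ ρ * m j := h1
        _ ≤ ρ * (ρ ^ j * ‖u‖ ^ 2) := by gcongr; exact ih (by omega)
        _ = _ := by ring
  have hcmp : lam ^ (2 * k) * c ≤ ρ ^ (2 * k) := by
    refine le_of_mul_le_mul_right ?_ hu2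
    calc lam ^ (2 * k) * c * ‖u‖ ^ 2 = lam ^ (2 * k) * (c * ‖u‖ ^ 2) := by ring
      _ ≤ lam ^ (2 * k) * ⟪v, u⟫ ^ 2 := by gcongr
      _ ≤ _ := (hlow k).trans (hup _ le_rfl)
  have hy := heven k ▸ hmpos (2 * k)
  refine ⟨(norm_nonneg _).lt_of_ne fun h0 => by simp [← h0] at hy, ?_⟩
  rw [← heven, ← hodd, ← le_div_iff₀ (hmpos _)]
  by_contra! hlt
  set a := Real.log c⁻¹ with ha
  have hk' : (0 : ℝ) < 2 * k := by positivity
  have hq : 0 < 1 - a / (2 * k) := by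
    by_contra! hq
    exact absurd (hρ0.trans hlt) (not_lt.2 (mul_nonpos_of_nonneg_of_nonpos hlam.le hq))
  have h1 : (1 - a / (2 * k)) ^ (2 * k) ≤ c := by
    calc (1 - a / (2 * k)) ^ (2 * k) ≤ Real.exp (-(a / (2 * k))) ^ (2 * k) := by
          gcongr
          linarith [Real.add_one_le_exp (-(a / (2 * k)))]
      _ = Real.exp (-a) := by
          rw [← Real.exp_nat_mul]
          congr 1
          push_cast
          field_simp
      _ = c := by rw [ha, Real.log_inv, neg_neg, Real.exp_log hc]
  have h2 : ρ ^ (2 * k) < (lam * (1 - a / (2 * k))) ^ (2 * k) :=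
    pow_lt_pow_left₀ hlt hρ0.le (by omega)
  rw [mul_pow] at h2
  exact absurd (hcmp.trans_lt h2) (not_lt.2 (by gcongr))

/-- A symmetric operator has a unit eigenvector that maximizes the Rayleigh quotient. -/
theorem LinearMap.IsSymmetric.exists_top_eigenvector [FiniteDimensional ℝ E] [Nontrivial E]
    {T : E →ₗ[ℝ] E} (hT : T.IsSymmetric) :
    ∃ (lam : ℝ) (v : E), ‖v‖ = 1 ∧ T v = lam • v ∧ ∀ x, ⟪T x, x⟫ ≤ lam * ‖x‖ ^ 2 := by
  let T' := hT.toSelfAdjoint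
  have hS : (Metric.sphere (0 : E) 1).Nonempty := (NormedSpace.sphere_nonempty).2 zero_le_one
  obtain ⟨v, hv, hmax⟩ := (isCompact_sphere (0 : E) 1).exists_isMaxOn hS
    T'.val.reApplyInnerSelf_continuous.continuousOn
  have hv1 : ‖v‖ = 1 := by simpa using hv
  have hmax' : IsMaxOn T'.val.reApplyInnerSelf (Metric.sphere (0 : E) ‖v‖) v := by rwa [hv1]
  have heig := IsSelfAdjoint.eq_smul_self_of_isLocalExtrOn_real T'.prop (Or.inr hmax'.localize)
  refine ⟨_, v, hv1, heig, fun x => ?_⟩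
  have hray : T'.val.rayleighQuotient v = ⟪T v, v⟫ := by
    rw [ContinuousLinearMap.rayleighQuotient, hv1]
    simp only [ContinuousLinearMap.reApplyInnerSelf, one_pow, div_one]
    rfl
  rw [hray]
  by_cases hx : x = 0
  · simp [hx]
  have hnx : ‖x‖ ≠ 0 := norm_ne_zero_iff.2 hx
  have h1 : ⟪T (‖x‖⁻¹ • x), ‖x‖⁻¹ • x⟫ ≤ ⟪T v, v⟫ := by
    exact hmax (show ‖x‖⁻¹ • x ∈ Metric.sphere (0 : E) 1 by simp [norm_smul, hnx])
  rw [map_smul, real_inner_smul_left, real_inner_smul_right] at h1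
  field_simp at h1
  linarith

end PowerMethod

/-! ### The spectrum of the normalized Laplacian -/

namespace WeightedGraph

open RealRAM
open scoped RealInnerProductSpace

variable {n : ℕ} (G : WeightedGraph (Fin n))

theorem degree_nonneg (i : Fin n) : 0 ≤ G.degree i :=
  Finset.sum_nonneg fun j _ => G.weight_nonneg i j

theorem weight_eq_zero_of_degree {i : Fin n} (h : G.degree i = 0) (j : Fin n) :
    G.weight i j = 0 :=
  (Finset.sum_eq_zero_iff_of_nonneg fun j _ => G.weight_nonneg i j).1 h j (Finset.mem_univ j)

theorem scale_sq_mul_degree (i : Fin n) :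
    G.scale i * G.scale i * G.degree i = if G.degree i = 0 then 0 else 1 := by
  split_ifs with h
  · simp [h]
  · have h1 := Real.mul_self_sqrt (G.degree_nonneg i)
    have h2 : √(G.degree i) ≠ 0 := fun h0 => h (by rw [← h1, h0, zero_mul])
    rw [scale]
    field_simp
    rw [pow_two, h1]

theorem scale_eq_zero {i : Fin n} (h : G.degree i = 0) : G.scale i = 0 := by simp [scale, h]

/-- The normalized Laplacian as an operator on the Euclidean space. -/
noncomputable def laplacianMap : EuclideanSpace ℝ (Fin n) →ₗ[ℝ] EuclideanSpace ℝ (Fin n) where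
  toFun u := WithLp.toLp 2 (G.laplacian u)
  map_add' u v := by
    ext i
    simp only [laplacian, PiLp.add_apply, mul_add, Finset.sum_add_distrib]
    ring
  map_smul' c u := by
    ext i
    simp only [laplacian, PiLp.smul_apply, smul_eq_mul, RingHom.id_apply, mul_sub, Finset.mul_sum]
    congr 1
    · ring
    · exact Finset.sum_congr rfl fun j _ => by ring

theorem laplacianMap_pow (u : EuclideanSpace ℝ (Fin n)) (k : ℕ) :
    ((G.laplacianMap ^ k) u : Fin n → ℝ) = G.laplacian^[k] u := by
  induction k with
  | zero => rfl
  | succ k ih =>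
    rw [pow_succ', Module.End.mul_apply, Function.iterate_succ_apply', ← ih]
    rfl

theorem inner_laplacianMap (u v : EuclideanSpace ℝ (Fin n)) :
    ⟪G.laplacianMap u, v⟫ = ∑ i, G.degree i * ((G.scale i * u i) * (G.scale i * v i)) -
      ∑ i, ∑ j, G.weight i j * ((G.scale i * v i) * (G.scale j * u j)) := by
  rw [← Finset.sum_sub_distrib, PiLp.inner_apply]
  refine Finset.sum_congr rfl fun i _ => ?_
  change v i * G.laplacian u i = _
  rw [laplacian, mul_sub, Finset.mul_sum]
  congr 1
  · ring
  · exact Finset.sum_congr rfl fun j _ => by ring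

theorem isSymmetric_laplacianMap : G.laplacianMap.IsSymmetric := by
  intro u v
  have h : ⟪u, G.laplacianMap v⟫ = ⟪G.laplacianMap v, u⟫ := real_inner_comm _ _
  rw [h, inner_laplacianMap, inner_laplacianMap, Finset.sum_comm]
  congr 1
  · exact Finset.sum_congr rfl fun i _ => by ring
  · refine Finset.sum_congr rfl fun i _ => Finset.sum_congr rfl fun j _ => ?_
    rw [G.weight_symm]
    ring

/-- The quadratic form of the normalized Laplacian. -/
theorem inner_laplacianMap_self (u : EuclideanSpace ℝ (Fin n)) :
    ⟪G.laplacianMap u, u⟫ =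
      (∑ i, ∑ j, G.weight i j * (G.scale i * u i - G.scale j * u j) ^ 2) / 2 := by
  have h1 := G.sum_degree_mul fun i => (G.scale i * u i) ^ 2
  have h2 := G.sum_degree_mul' fun i => (G.scale i * u i) ^ 2
  have h3 : ∀ i j, G.weight i j * (G.scale i * u i - G.scale j * u j) ^ 2 =
      G.weight i j * (G.scale i * u i) ^ 2 + G.weight i j * (G.scale j * u j) ^ 2 -
        2 * (G.weight i j * ((G.scale i * u i) * (G.scale j * u j))) := fun i j => by ring
  rw [inner_laplacianMap]
  simp only [h3, Finset.sum_add_distrib, Finset.sum_sub_distrib, ← Finset.mul_sum, ← pow_two]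
  rw [← h1, ← h2]
  ring

theorem sum_weight_add_sq (x : Fin n → ℝ) :
    ∑ i, ∑ j, G.weight i j * (x i + x j) ^ 2 =
      4 * ∑ i, G.degree i * x i ^ 2 - ∑ i, ∑ j, G.weight i j * (x i - x j) ^ 2 := by
  have h1 := G.sum_degree_mul fun i => x i ^ 2
  have h2 := G.sum_degree_mul' fun i => x i ^ 2
  have h3 : ∀ i j, G.weight i j * (x i + x j) ^ 2 =
      2 * (G.weight i j * x i ^ 2) + 2 * (G.weight i j * x j ^ 2) -
        G.weight i j * (x i - x j) ^ 2 := fun i j => by ring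
  simp only [h3, Finset.sum_add_distrib, Finset.sum_sub_distrib, ← Finset.mul_sum]
  rw [← h1, ← h2]
  ring

theorem inner_laplacianMap_nonneg (u : EuclideanSpace ℝ (Fin n)) : 0 ≤ ⟪G.laplacianMap u, u⟫ := by
  rw [inner_laplacianMap_self]
  exact div_nonneg (Finset.sum_nonneg fun i _ => Finset.sum_nonneg fun j _ =>
    mul_nonneg (G.weight_nonneg i j) (sq_nonneg _)) zero_le_two

theorem sum_degree_scale_le (u : EuclideanSpace ℝ (Fin n)) :
    ∑ i, G.degree i * (G.scale i * u i) ^ 2 ≤ ‖u‖ ^ 2 := by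
  rw [EuclideanSpace.real_norm_sq_eq]
  refine Finset.sum_le_sum fun i _ => ?_
  have : G.degree i * (G.scale i * u i) ^ 2 = (G.scale i * G.scale i * G.degree i) * u i ^ 2 := by
    ring
  rw [this, scale_sq_mul_degree]
  split_ifs
  · simpa using sq_nonneg (u i)
  · simp

/-- Vectors in the range of the normalized Laplacian vanish at the vertices of degree `0`. -/
theorem sum_degree_scale_laplacianMap (w : EuclideanSpace ℝ (Fin n)) :
    ∑ i, G.degree i * (G.scale i * G.laplacianMap w i) ^ 2 = ‖G.laplacianMap w‖ ^ 2 := by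
  rw [EuclideanSpace.real_norm_sq_eq]
  refine Finset.sum_congr rfl fun i _ => ?_
  have : ∀ z, G.degree i * (G.scale i * z) ^ 2 = (G.scale i * G.scale i * G.degree i) * z ^ 2 := by
    intro z; ring
  rw [this, scale_sq_mul_degree]
  split_ifs with h
  · have : G.laplacianMap w i = G.laplacian w i := rfl
    rw [this]
    simp [laplacian, h, G.scale_eq_zero h]
  · simp

theorem inner_laplacianMap_le (u : EuclideanSpace ℝ (Fin n)) :
    ⟪G.laplacianMap u, u⟫ ≤ 2 * ‖u‖ ^ 2 := by
  have h1 := G.sum_weight_add_sq fun i => G.scale i * u i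
  have h2 := G.inner_laplacianMap_self u
  have h3 := G.sum_degree_scale_le u
  have h4 : 0 ≤ ∑ i, ∑ j, G.weight i j * (G.scale i * u i + G.scale j * u j) ^ 2 :=
    Finset.sum_nonneg fun i _ => Finset.sum_nonneg fun j _ =>
      mul_nonneg (G.weight_nonneg i j) (sq_nonneg _)
  linarith

theorem sum_degree : ∑ i, G.degree i = 2 * G.totalWeight := by
  simp only [degree, totalWeight]; ring

/-- The test vector of a cut: its Rayleigh quotient is twice the fraction of the weight cut. -/
theorem cutWeight_le {lam : ℝ}
    (h : ∀ u : EuclideanSpace ℝ (Fin n), ⟪G.laplacianMap u, u⟫ ≤ lam * ‖u‖ ^ 2)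
    (S : Finset (Fin n)) : 2 * G.cutWeight S ≤ lam * G.totalWeight := by
  set c : Fin n → ℝ := fun i => if i ∈ S then 1 else -1 with hc
  have hc2 : ∀ i, c i ^ 2 = 1 := fun i => by simp only [hc]; split_ifs <;> norm_num
  let z : EuclideanSpace ℝ (Fin n) := WithLp.toLp 2 fun i => √(G.degree i) * c i
  have hz : ‖z‖ ^ 2 = 2 * G.totalWeight := by
    rw [EuclideanSpace.real_norm_sq_eq, ← sum_degree]
    refine Finset.sum_congr rfl fun i _ => ?_
    change (√(G.degree i) * c i) ^ 2 = _
    rw [mul_pow, hc2, Real.sq_sqrt (G.degree_nonneg i), mul_one]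
  have hx : ∀ i, G.degree i ≠ 0 → G.scale i * z i = c i := by
    intro i hi
    change G.scale i * (√(G.degree i) * c i) = c i
    have : √(G.degree i) ≠ 0 := (Real.sqrt_ne_zero (G.degree_nonneg i)).2 hi
    rw [scale]
    field_simp
  have h1 := h z
  rw [inner_laplacianMap_self, hz] at h1
  have h2 : ∑ i, ∑ j, G.weight i j * (G.scale i * z i - G.scale j * z j) ^ 2 =
      ∑ i, ∑ j, ((if i ∈ S then if j ∈ Sᶜ then 4 * G.weight i j else 0 else 0) +
        if j ∈ S then if i ∈ Sᶜ then 4 * G.weight j i else 0 else 0) := by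
    refine Finset.sum_congr rfl fun i _ => Finset.sum_congr rfl fun j _ => ?_
    by_cases hi : G.degree i = 0
    · simp [G.weight_eq_zero_of_degree hi j, G.weight_symm j i]
    by_cases hj : G.degree j = 0
    · simp [G.weight_eq_zero_of_degree hj i, G.weight_symm i j]
    rw [hx i hi, hx j hj]
    by_cases hiS : i ∈ S <;> by_cases hjS : j ∈ S <;> simp [hc, hiS, hjS, G.weight_symm j i] <;>
      ring
  have h3 : ∑ i, ∑ j, (if i ∈ S then if j ∈ Sᶜ then 4 * G.weight i j else 0 else 0) =
      4 * G.cutWeight S := by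
    have h5 : ∀ i, ∑ j, (if i ∈ S then if j ∈ Sᶜ then 4 * G.weight i j else 0 else 0) =
        if i ∈ S then ∑ j ∈ Sᶜ, 4 * G.weight i j else 0 := by
      intro i
      split_ifs
      · rw [Finset.sum_ite_mem, Finset.univ_inter]
      · simp
    rw [Finset.sum_congr rfl fun i _ => h5 i, Finset.sum_ite_mem, Finset.univ_inter, cutWeight]
    simp only [Finset.mul_sum]
  have h4 : ∑ i, ∑ j, (if j ∈ S then if i ∈ Sᶜ then 4 * G.weight j i else 0 else 0) =
      4 * G.cutWeight S := by rw [Finset.sum_comm, h3]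
  rw [h2] at h1
  simp only [Finset.sum_add_distrib] at h1
  rw [h3, h4] at h1
  linarith

theorem exists_degree_pos (hG : 0 < G.totalWeight) : ∃ i, 0 < G.degree i := by
  by_contra! h
  have := G.sum_degree
  have h' : ∑ i, G.degree i ≤ 0 := Finset.sum_nonpos fun i _ => h i
  linarith

theorem two_le_of_totalWeight_pos (hG : 0 < G.totalWeight) : 2 ≤ n := by
  obtain ⟨i, hi⟩ := G.exists_degree_pos hG
  obtain ⟨j, -, hj⟩ := Finset.exists_ne_zero_of_sum_ne_zero hi.ne'
  have hij : i ≠ j := fun h => hj (h ▸ G.weight_self i)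
  have := Fin.val_ne_of_ne hij
  omega

/-- The number of steps suffices to reduce the influence of the initial vector, which may lose a
factor `36 * n ^ 2` against the eigenvector, to `δ ^ 2 / 16`. -/
theorem log_six_mul_le (hn : 2 ≤ n) {δ : ℝ} (hδ : 0 < δ) :
    16 * Real.log (6 * n) ≤ powerSteps n δ * δ ^ 2 := by
  have hn' : (0 : ℝ) < n := by positivity
  set L := Nat.clog 2 n with hL
  have h1 : Real.log n ≤ L := by
    have h2 : (n : ℝ) ≤ 2 ^ L := by exact_mod_cast Nat.le_pow_clog (by decide) n
    calc Real.log n ≤ Real.log (2 ^ L) := Real.log_le_log hn' h2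
      _ = L * Real.log 2 := by rw [Real.log_pow]
      _ ≤ L * 1 := by gcongr; linarith [Real.log_two_lt_d9]
      _ = L := mul_one _
  have h2 : (1 : ℝ) ≤ L := by
    exact_mod_cast Nat.clog_pos (by decide) hn
  have h3 : Real.log 6 ≤ 5 := by
    have := Real.log_le_sub_one_of_pos (show (0 : ℝ) < 6 by norm_num)
    linarith
  have h4 : 100 * (L : ℝ) / δ ^ 2 < powerSteps n δ := by
    rw [powerSteps]; push_cast; exact Nat.lt_floor_add_one _
  rw [div_lt_iff₀ (by positivity)] at h4
  rw [Real.log_mul (by norm_num) hn'.ne']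
  linarith

/-- With a good initial vector, the power method finds a vector with a small Rayleigh quotient for
`D + A`. The vector `v` is a top eigenvector of the normalized Laplacian; the bounds on `u` are those
that a random vector with entries in `{0, 1, 2, 3}` satisfies. -/
theorem exists_good_direction (hG : 0 < G.totalWeight) :
    ∃ v : Fin n → ℝ, ∑ i, v i ^ 2 = 1 ∧ ∀ {δ ε : ℝ} {u : Fin n → ℝ}, 0 < δ → 1 - ε ≤ G.maxCut →
      ∑ i, u i ^ 2 ≤ 9 * n → 1 / (4 * n) ≤ (∑ i, v i * u i) ^ 2 →
      let x : Fin n → ℝ := fun i => G.scale i * (G.laplacian^[powerSteps n δ] u) i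
      0 < ∑ i, G.degree i * x i ^ 2 ∧ ∑ i, ∑ j, G.weight i j * (x i + x j) ^ 2 ≤
        2 * (2 * ε + δ ^ 2 / 8) * ∑ i, G.degree i * x i ^ 2 := by
  have hn := G.two_le_of_totalWeight_pos hG
  have hn' : (0 : ℝ) < n := by positivity
  obtain ⟨i, hi⟩ := G.exists_degree_pos hG
  have : Nonempty (Fin n) := ⟨i⟩
  obtain ⟨lam, v, hv, hTv, hmax⟩ := G.isSymmetric_laplacianMap.exists_top_eigenvector
  have hlam0 : 0 < lam := by
    -- A single vertex of positive degree is a cut of positive weight.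
    have h1 := G.cutWeight_le hmax {i}
    have h2 : G.cutWeight {i} = G.degree i := by
      rw [cutWeight, Finset.sum_singleton, degree, ← Finset.sum_compl_add_sum {i},
        Finset.sum_singleton, weight_self, add_zero]
    rw [h2] at h1
    exact pos_of_mul_pos_left (by linarith) hG.le
  have hlam2 : lam ≤ 2 := by
    have h1 := G.inner_laplacianMap_le v
    rw [hTv, real_inner_smul_left, real_inner_self_eq_norm_sq, hv] at h1
    linarith
  refine ⟨v, by rw [← EuclideanSpace.real_norm_sq_eq, hv, one_pow], ?_⟩
  intro δ ε u hδ hε hu hvu x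
  have hlam : 2 - 2 * ε ≤ lam := by
    obtain ⟨S, -, hS⟩ := Finset.exists_mem_eq_sup' (⟨∅, Finset.mem_univ ∅⟩ :
      (Finset.univ : Finset (Finset (Fin n))).Nonempty) fun S => G.cutWeight S / G.totalWeight
    have h1 : 1 - ε ≤ G.cutWeight S / G.totalWeight := hS ▸ hε
    rw [le_div_iff₀ hG] at h1
    have h2 := G.cutWeight_le hmax S
    exact le_of_mul_le_mul_right (by linarith) hG
  let U : EuclideanSpace ℝ (Fin n) := WithLp.toLp 2 u
  have hUn : ‖U‖ ^ 2 = ∑ i, u i ^ 2 := EuclideanSpace.real_norm_sq_eq U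
  have hvU : ⟪v, U⟫ = ∑ i, v i * u i := by
    rw [PiLp.inner_apply]
    exact Finset.sum_congr rfl fun i _ => mul_comm _ _
  have hU0 : U ≠ 0 := by
    intro h0
    rw [← hvU, h0, inner_zero_right] at hvu
    have : (0 : ℝ) < 1 / (4 * n) := by positivity
    linarith
  set k := powerSteps n δ with hk
  have hk0 : 0 < k := by rw [hk, powerSteps]; omega
  have hk0' : (0 : ℝ) < k := by exact_mod_cast hk0
  obtain ⟨hy, hpow⟩ := G.isSymmetric_laplacianMap.power_method (c := ((6 * n : ℝ) ^ 2)⁻¹)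
    G.inner_laplacianMap_nonneg hlam0 hv hTv (by positivity) hU0 (by
      rw [hvU, hUn]
      refine le_trans ?_ hvu
      calc ((6 * n : ℝ) ^ 2)⁻¹ * ∑ i, u i ^ 2 ≤ ((6 * n : ℝ) ^ 2)⁻¹ * (9 * n) := by gcongr
        _ = 1 / (4 * n) := by field_simp; norm_num) hk0
  have hxy : x = fun i => G.scale i * (G.laplacianMap ^ k) U i := by
    funext i
    rw [laplacianMap_pow]
  have hS : ∑ i, G.degree i * x i ^ 2 = ‖(G.laplacianMap ^ k) U‖ ^ 2 := by
    rw [hxy]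
    obtain ⟨k', hk'⟩ := Nat.exists_eq_succ_of_ne_zero hk0.ne'
    rw [hk', pow_succ', Module.End.mul_apply]
    exact G.sum_degree_scale_laplacianMap _
  refine ⟨by rw [hS]; positivity, ?_⟩
  rw [sum_weight_add_sq, hS]
  have hq := G.inner_laplacianMap_self ((G.laplacianMap ^ k) U)
  have hxy' : ∀ i, G.scale i * (G.laplacianMap ^ k) U i = x i := fun i => by rw [hxy]
  simp only [hxy'] at hq
  have hlog : Real.log (((6 * n : ℝ) ^ 2)⁻¹)⁻¹ / (2 * k) ≤ δ ^ 2 / 16 := by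
    rw [inv_inv, Real.log_pow, div_le_iff₀ (by positivity)]
    have := log_six_mul_le hn hδ
    push_cast
    linarith
  have h1 : lam - δ ^ 2 / 8 ≤ lam * (1 - Real.log (((6 * n : ℝ) ^ 2)⁻¹)⁻¹ / (2 * k)) := by
    nlinarith [sq_nonneg δ]
  have h2 : (2 - 2 * ε - δ ^ 2 / 8) * ‖(G.laplacianMap ^ k) U‖ ^ 2 ≤
      lam * (1 - Real.log (((6 * n : ℝ) ^ 2)⁻¹)⁻¹ / (2 * k)) * ‖(G.laplacianMap ^ k) U‖ ^ 2 := by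
    gcongr
    linarith
  linarith

end WeightedGraph

/-! ### Rounding -/

/-- Summation by parts: the differences of `t` from `a` on add up to `t a - t n`. -/
theorem sum_range_ite_sub (t : ℕ → ℝ) {a n : ℕ} (h : a ≤ n) :
    ∑ k ∈ Finset.range n, (t k - t (k + 1)) * (if a < k + 1 then 1 else 0) = t a - t n := by
  induction n, h using Nat.le_induction with
  | base =>
    rw [sub_self]
    refine Finset.sum_eq_zero fun k hk => ?_
    rw [if_neg (by have := Finset.mem_range.1 hk; omega), mul_zero]
  | succ n h ih =>
    rw [Finset.sum_range_succ, ih, if_pos (by omega)]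
    ring

namespace WeightedGraph

variable {n : ℕ} {G : WeightedGraph (Fin n)}

/-- The `k`-th largest square of an entry of `x`, and `0` for `k ≥ n`. -/
noncomputable def level (σ : Equiv.Perm (Fin n)) (x : Fin n → ℝ) (k : ℕ) : ℝ :=
  if h : k < n then x (σ.symm ⟨k, h⟩) ^ 2 else 0

variable {σ : Equiv.Perm (Fin n)} {x : Fin n → ℝ}

theorem level_apply (i : Fin n) : level σ x (σ i) = x i ^ 2 := by
  simp [level]

theorem level_succ_le (hσ : ∀ i j, σ i ≤ σ j → x j ^ 2 ≤ x i ^ 2) (k : ℕ) :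
    level σ x (k + 1) ≤ level σ x k := by
  unfold level
  split_ifs with h1 h2
  · refine hσ _ _ ?_
    simp
  · omega
  · exact sq_nonneg _
  · exact le_rfl

theorem sum_level_sub (i : Fin n) : ∑ k ∈ Finset.range n,
    (level σ x k - level σ x (k + 1)) * (if (σ i : ℕ) < k + 1 then 1 else 0) = x i ^ 2 := by
  rw [sum_range_ite_sub _ (σ i).2.le, level_apply, level, dif_neg (lt_irrefl n), sub_zero]

/-- The average of the cost of a pair of vertices over all thresholds. -/
theorem sum_level_sub_mul_abs_le (hσ : ∀ i j, σ i ≤ σ j → x j ^ 2 ≤ x i ^ 2) (i j : Fin n) :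
    ∑ k ∈ Finset.range n, (level σ x k - level σ x (k + 1)) *
      |prefixCut σ x (k + 1) i + prefixCut σ x (k + 1) j| ≤ |x i + x j| * (|x i| + |x j|) := by
  -- For the ends `i` and `j` in this order, `i` alone counts between the two thresholds.
  wlog hij : σ i ≤ σ j generalizing i j
  · simpa only [add_comm] using this j i (le_of_not_ge hij)
  have h1 : ∀ k, |prefixCut σ x (k + 1) i + prefixCut σ x (k + 1) j| =
      (if (σ i : ℕ) < k + 1 then 1 else 0) +
        (signOf (x i) * signOf (x j)) * (if (σ j : ℕ) < k + 1 then 1 else 0) := by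
    intro k
    have hij' : (σ i : ℕ) ≤ σ j := hij
    unfold prefixCut
    by_cases hi : (σ i : ℕ) < k + 1 <;> by_cases hj : (σ j : ℕ) < k + 1
    · rcases signOf_eq (x i) with h | h <;> rcases signOf_eq (x j) with h' | h' <;>
        (simp [hi, hj, h, h']; try norm_num)
    · rcases signOf_eq (x i) with h | h <;> simp [hi, hj, h]
    · omega
    · simp [hi, hj]
  simp only [h1, mul_add, Finset.sum_add_distrib, mul_left_comm _ (signOf (x i) * signOf (x j)),
    ← Finset.mul_sum, sum_level_sub]
  have hle := hσ i j hij
  rw [← mul_add]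
  have hopp : x i ^ 2 - x j ^ 2 ≤ |x i + x j| * (|x i| + |x j|) := by
    have h2 : |x i| - |x j| ≤ |x i + x j| := by
      simpa using abs_sub_abs_le_abs_sub (x i) (-x j)
    rw [← sq_abs (x i), ← sq_abs (x j), sq_sub_sq, mul_comm]
    gcongr
  unfold signOf
  split_ifs with hi hj hj
  · rw [abs_of_nonneg hi, abs_of_nonneg hj, abs_of_nonneg (add_nonneg hi hj)]
    nlinarith
  · linarith
  · linarith
  · rw [abs_of_neg (not_le.1 hi), abs_of_neg (not_le.1 hj),
      abs_of_neg (add_neg (not_le.1 hi) (not_le.1 hj))]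
    nlinarith

theorem sum_mul_sq_le (f g : Fin n → Fin n → ℝ) :
    (∑ i, ∑ j, G.weight i j * (f i j * g i j)) ^ 2 ≤
      (∑ i, ∑ j, G.weight i j * f i j ^ 2) * ∑ i, ∑ j, G.weight i j * g i j ^ 2 := by
  have h := Finset.sum_mul_sq_le_sq_mul_sq (Finset.univ : Finset (Fin n × Fin n))
    (fun p => √(G.weight p.1 p.2) * f p.1 p.2) (fun p => √(G.weight p.1 p.2) * g p.1 p.2)
  have h1 : ∀ i j, √(G.weight i j) ^ 2 = G.weight i j := fun i j =>
    Real.sq_sqrt (G.weight_nonneg i j)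
  have h2 : ∀ i j, √(G.weight i j) * f i j * (√(G.weight i j) * g i j) =
      G.weight i j * (f i j * g i j) := fun i j => by
    rw [← h1 i j, Real.sqrt_sq (Real.sqrt_nonneg _)]; ring
  simpa only [Fintype.sum_prod_type, mul_pow, h1, h2] using h

/-- The rounding of a vector with a small Rayleigh quotient for `D + A`: the partial cuts at the
thresholds, weighted by the differences of consecutive thresholds, have on average a small cost, and
the best one is at least as good. -/
theorem IsSweepCut.uncut_le {y : Fin n → ℝ} (h : G.IsSweepCut x y)
    (hx : ∀ i, G.degree i = 0 → x i = 0) (hS : 0 < ∑ i, G.degree i * x i ^ 2) {R : ℝ}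
    (hR : ∑ i, ∑ j, G.weight i j * (x i + x j) ^ 2 ≤ R * ∑ i, G.degree i * x i ^ 2) :
    0 < G.volume y ∧ G.uncut y ≤ √(4 * R) * G.volume y := by
  obtain ⟨σ, b, hσ, -, hopt⟩ := h
  set S := ∑ i, G.degree i * x i ^ 2 with hSdef
  -- The first vertex has the largest entry, which is nonzero, hence positive degree.
  obtain ⟨i₀, -, hi₀⟩ := Finset.exists_ne_zero_of_sum_ne_zero hS.ne'
  have hn : 0 < n := i₀.pos
  have hd : 0 < G.degree (σ.symm ⟨0, hn⟩) := by
    have h1 : 0 < x i₀ ^ 2 := (sq_nonneg _).lt_of_ne' (right_ne_zero_of_mul hi₀)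
    have h2 := hσ (σ.symm ⟨0, hn⟩) i₀ (by rw [Equiv.apply_symm_apply]; exact Nat.zero_le _)
    refine (G.degree_nonneg _).lt_of_ne' fun h0 => ?_
    rw [hx _ h0] at h2
    linarith
  have hvol : ∀ r, 1 ≤ r → 0 < G.volume (prefixCut σ x r) := by
    intro r hr
    rw [volume_prefixCut]
    refine Finset.sum_pos' (fun i _ => ?_) ⟨σ.symm ⟨0, hn⟩, Finset.mem_univ _, ?_⟩
    · split_ifs
      exacts [G.degree_nonneg i, le_rfl]
    · rw [if_pos (by rw [Equiv.apply_symm_apply]; exact hr)]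
      exact hd
  replace hopt := hopt hvol
  obtain ⟨hy, -⟩ := hopt 1 le_rfl hn
  refine ⟨hy, ?_⟩
  set g : ℕ → ℝ := fun k => level σ x k - level σ x (k + 1) with hg
  have hg0 : ∀ k, 0 ≤ g k := fun k => sub_nonneg.2 (level_succ_le hσ k)
  have hV : ∑ k ∈ Finset.range n, g k * G.volume (prefixCut σ x (k + 1)) = S := by
    simp only [volume_prefixCut, Finset.mul_sum]
    rw [Finset.sum_comm]
    refine Finset.sum_congr rfl fun i _ => ?_
    rw [← sum_level_sub (σ := σ) (x := x) i, Finset.mul_sum]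
    refine Finset.sum_congr rfl fun k _ => ?_
    split_ifs
    · rw [mul_one, mul_comm]
    · simp
  have hU : ∑ k ∈ Finset.range n, g k * G.uncut (prefixCut σ x (k + 1)) ≤
      ∑ i, ∑ j, G.weight i j * (|x i + x j| * (|x i| + |x j|)) := by
    simp only [uncut, Finset.mul_sum]
    rw [Finset.sum_comm]
    refine Finset.sum_le_sum fun i _ => ?_
    rw [Finset.sum_comm]
    refine Finset.sum_le_sum fun j _ => ?_
    simp only [mul_left_comm _ (G.weight i j), ← Finset.mul_sum]
    exact mul_le_mul_of_nonneg_left (sum_level_sub_mul_abs_le hσ i j) (G.weight_nonneg i j)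
  have hCS : ∑ i, ∑ j, G.weight i j * (|x i + x j| * (|x i| + |x j|)) ≤ √(4 * R) * S := by
    have h1 := G.sum_mul_sq_le (fun i j => |x i + x j|) (fun i j => |x i| + |x j|)
    simp only [sq_abs] at h1
    have h2 : ∑ i, ∑ j, G.weight i j * (|x i| + |x j|) ^ 2 ≤ 4 * S := by
      have h3 := G.sum_weight_add_sq fun i => |x i|
      simp only [sq_abs] at h3
      have h4 : 0 ≤ ∑ i, ∑ j, G.weight i j * (|x i| - |x j|) ^ 2 :=
        Finset.sum_nonneg fun i _ => Finset.sum_nonneg fun j _ =>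
          mul_nonneg (G.weight_nonneg i j) (sq_nonneg _)
      linarith
    have h3 : 0 ≤ ∑ i, ∑ j, G.weight i j * (x i + x j) ^ 2 :=
      Finset.sum_nonneg fun i _ => Finset.sum_nonneg fun j _ =>
        mul_nonneg (G.weight_nonneg i j) (sq_nonneg _)
    calc _ ≤ √(4 * R * S ^ 2) := by
          refine Real.le_sqrt_of_sq_le (h1.trans ?_)
          calc _ ≤ (R * S) * (4 * S) := mul_le_mul hR h2
                (Finset.sum_nonneg fun i _ => Finset.sum_nonneg fun j _ =>
                  mul_nonneg (G.weight_nonneg i j) (sq_nonneg _)) (h3.trans hR)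
            _ = _ := by ring
      _ = √(4 * R) * S := by rw [Real.sqrt_mul' _ (sq_nonneg S), Real.sqrt_sq hS.le]
  refine le_of_mul_le_mul_right ?_ hS
  calc G.uncut y * S = ∑ k ∈ Finset.range n, g k * (G.uncut y * G.volume (prefixCut σ x (k + 1))) := by
        rw [← hV, Finset.mul_sum]
        exact Finset.sum_congr rfl fun k _ => by ring
    _ ≤ ∑ k ∈ Finset.range n, g k * (G.uncut (prefixCut σ x (k + 1)) * G.volume y) := by
        refine Finset.sum_le_sum fun k hk => mul_le_mul_of_nonneg_left ?_ (hg0 k)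
        exact (hopt (k + 1) (by omega) (Finset.mem_range.1 hk)).2
    _ = (∑ k ∈ Finset.range n, g k * G.uncut (prefixCut σ x (k + 1))) * G.volume y := by
        rw [Finset.sum_mul]
        exact Finset.sum_congr rfl fun k _ => by ring
    _ ≤ √(4 * R) * S * G.volume y := by gcongr; exact hU.trans hCS
    _ = √(4 * R) * G.volume y * S := by ring

end WeightedGraph

/-! ### The random initial vector -/

namespace RealRAM

open MeasureTheory

/-- The sequence of coin flips with the flip number `p` inverted. -/
def invertCoin (p : ℕ) (ω : ℕ → Bool) : ℕ → Bool := Function.update ω p (!ω p)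

theorem measurePreserving_invertCoin (p : ℕ) :
    MeasurePreserving (invertCoin p) coinMeasure coinMeasure := by
  have h1 : invertCoin p = fun ω i => (if i = p then Bool.not else id) (ω i) := by
    funext ω i
    by_cases h : i = p <;> simp [invertCoin, h]
  have h2 : Measurable (invertCoin p) := by
    rw [h1]
    exact measurable_pi_lambda _ fun i => (measurable_of_finite _).comp (measurable_pi_apply i)
  refine ⟨h2, ?_⟩
  rw [coinMeasure, h1, Measure.infinitePi_map_pi]
  · congr 1
    funext i
    have h3 : ∀ f : Bool → Bool, Function.Bijective f →
        (PMF.uniformOfFintype Bool).toMeasure.map f = (PMF.uniformOfFintype Bool).toMeasure := by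
      intro f hf
      rw [PMF.toMeasure_map _ _ (measurable_of_finite f)]
      congr 1
      ext b
      obtain ⟨a, rfl⟩ := hf.2 b
      rw [PMF.map_apply, tsum_eq_single a fun a' ha' => by simp [hf.1.ne ha'.symm]]
      simp
    refine h3 _ ?_
    split_ifs
    · exact Bool.involutive_not.bijective
    · exact Function.bijective_id
  · exact fun i => measurable_of_finite _

theorem start_invertCoin_even (i j : ℕ) (ω : ℕ → Bool) :
    start (invertCoin (2 * i) ω) j =
      start ω j + if j = i then 1 - 2 * ((ω (2 * i)).toNat : ℝ) else 0 := by
  have h : 2 * j + 1 ≠ 2 * i := by omega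
  by_cases hj : j = i
  · subst hj
    cases h' : ω (2 * j) <;> (simp [start, invertCoin, h']; try ring)
  · simp [start, invertCoin, hj, h]

theorem start_invertCoin_odd (i j : ℕ) (ω : ℕ → Bool) :
    start (invertCoin (2 * i + 1) ω) j =
      start ω j + if j = i then 2 - 4 * ((ω (2 * i + 1)).toNat : ℝ) else 0 := by
  have h : 2 * j ≠ 2 * i + 1 := by omega
  by_cases hj : j = i
  · subst hj
    cases h' : ω (2 * j + 1) <;> (simp [start, invertCoin, h']; try ring)
  · simp [start, invertCoin, hj, h]

theorem start_nonneg (ω : ℕ → Bool) (i : ℕ) : 0 ≤ start ω i := by unfold start; positivity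

theorem start_le (ω : ℕ → Bool) (i : ℕ) : start ω i ≤ 3 := by
  unfold start
  cases ω (2 * i) <;> cases ω (2 * i + 1) <;> norm_num

/-- The random initial vector is not nearly orthogonal to a given unit vector. Let the entry number
`i` of the unit vector be one of the largest. From a sequence of coin flips, inverting one or the
other of the two coins for entry number `i` gives two more sequences. The three inner products
differ pairwise by at least `|v i|`, so at most one of them is small. -/
theorem two_thirds_le_coinMeasure {n : ℕ} {v : Fin n → ℝ} (hv : ∑ i, v i ^ 2 = 1) :
    2 / 3 ≤ coinMeasure {ω | 1 / (4 * n) ≤ (∑ i, v i * start ω i) ^ 2} := by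
  have hprob : IsProbabilityMeasure coinMeasure := by unfold coinMeasure; infer_instance
  have hn : 0 < n := by
    rcases Nat.eq_zero_or_pos n with rfl | h
    · simp at hv
    · exact h
  have hn' : (0 : ℝ) < n := by exact_mod_cast hn
  obtain ⟨i, hi⟩ : ∃ i, 1 / (n : ℝ) ≤ v i ^ 2 := by
    by_contra! h
    have h1 : ∑ i, v i ^ 2 < ∑ _i : Fin n, 1 / (n : ℝ) :=
      Finset.sum_lt_sum_of_nonempty ⟨⟨0, hn⟩, Finset.mem_univ _⟩ fun i _ => h i
    rw [hv, Finset.sum_const, Finset.card_univ, Fintype.card_fin, nsmul_eq_mul,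
      mul_one_div_cancel hn'.ne'] at h1
    exact lt_irrefl _ h1
  set Z : (ℕ → Bool) → ℝ := fun ω => ∑ i, v i * start ω i with hZ
  have hZm : Measurable Z := by
    refine Finset.measurable_sum _ fun i _ => Measurable.const_mul ?_ _
    unfold start
    exact (((measurable_of_finite fun b : Bool => (b.toNat : ℝ)).comp (measurable_pi_apply _)).add
      (((measurable_of_finite fun b : Bool => (b.toNat : ℝ)).comp
        (measurable_pi_apply _)).const_mul 2))
  have hZ0 : ∀ ω, Z (invertCoin (2 * i) ω) = Z ω + v i * (1 - 2 * ((ω (2 * i)).toNat : ℝ)) := by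
    intro ω
    simp only [hZ, start_invertCoin_even, mul_add, Finset.sum_add_distrib, Fin.val_inj]
    simp
  have hZ1 : ∀ ω, Z (invertCoin (2 * i + 1) ω) =
      Z ω + v i * (2 - 4 * ((ω (2 * i + 1)).toNat : ℝ)) := by
    intro ω
    simp only [hZ, start_invertCoin_odd, mul_add, Finset.sum_add_distrib, Fin.val_inj]
    simp
  set B : Set (ℕ → Bool) := {ω | Z ω ^ 2 < 1 / (4 * n)} with hB
  have hBm : MeasurableSet B := measurableSet_lt (hZm.pow_const 2) measurable_const
  -- Two small numbers differ by less than `|v i|`.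
  have hsmall : ∀ {a c : ℝ}, a ^ 2 < 1 / (4 * n) → (a + v i * c) ^ 2 < 1 / (4 * n) → c ^ 2 < 1 := by
    intro a c ha hc
    have h1 : (v i * c) ^ 2 < 1 / n := by
      have h2 : (1 : ℝ) / n = 4 * (1 / (4 * n)) := by field_simp
      nlinarith [sq_nonneg (a + (a + v i * c))]
    rw [mul_pow] at h1
    by_contra! hc1
    nlinarith [mul_le_mul_of_nonneg_left hc1 (sq_nonneg (v i))]
  set B0 := invertCoin (2 * i) ⁻¹' B with hB0
  set B1 := invertCoin (2 * i + 1) ⁻¹' B with hB1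
  have hμ0 : coinMeasure B0 = coinMeasure B :=
    (measurePreserving_invertCoin _).measure_preimage hBm.nullMeasurableSet
  have hμ1 : coinMeasure B1 = coinMeasure B :=
    (measurePreserving_invertCoin _).measure_preimage hBm.nullMeasurableSet
  have hB0m : MeasurableSet B0 := (measurePreserving_invertCoin _).measurable hBm
  have hB1m : MeasurableSet B1 := (measurePreserving_invertCoin _).measurable hBm
  have hd0 : Disjoint B B0 := by
    rw [Set.disjoint_left]
    intro ω h h0
    have h0 : Z (invertCoin (2 * i) ω) ^ 2 < 1 / (4 * n) := h0
    rw [hZ0] at h0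
    have := hsmall h h0
    cases h' : ω (2 * i) <;> rw [h'] at this <;> norm_num at this
  have hd1 : Disjoint (B ∪ B0) B1 := by
    rw [Set.disjoint_left]
    intro ω h h1
    have h1 : Z (invertCoin (2 * i + 1) ω) ^ 2 < 1 / (4 * n) := h1
    rw [hZ1] at h1
    rcases h with h | h0
    · have := hsmall h h1
      cases h' : ω (2 * i + 1) <;> rw [h'] at this <;> norm_num at this
    · have h0 : Z (invertCoin (2 * i) ω) ^ 2 < 1 / (4 * n) := h0
      rw [hZ0] at h0
      have := hsmall (c := (2 - 4 * ((ω (2 * i + 1)).toNat : ℝ)) -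
        (1 - 2 * ((ω (2 * i)).toNat : ℝ))) h0 (by convert h1 using 2; ring)
      cases h' : ω (2 * i + 1) <;> cases h'' : ω (2 * i) <;> rw [h', h''] at this <;>
        norm_num at this
  have hsum : 3 * coinMeasure B ≤ 1 := by
    calc 3 * coinMeasure B = coinMeasure (B ∪ B0 ∪ B1) := by
          rw [measure_union hd1 hB1m, measure_union hd0 hB0m, hμ0, hμ1]; ring
      _ ≤ 1 := prob_le_one
  have hcompl : {ω | 1 / (4 * (n : ℝ)) ≤ Z ω ^ 2} = Bᶜ := by
    ext ω; simp [hB]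
  rw [hcompl, prob_compl_eq_one_sub hBm]
  have hB3 : coinMeasure B ≤ 1 / 3 := by
    rw [ENNReal.le_div_iff_mul_le (by simp) (by simp), mul_comm]
    exact hsum
  refine ENNReal.le_sub_of_add_le_right (measure_ne_top _ _) ?_
  calc (2 / 3 : ENNReal) + coinMeasure B ≤ 2 / 3 + 1 / 3 := by gcongr
    _ = 1 := by rw [← ENNReal.add_div, two_add_one_eq_three, ENNReal.div_self (by simp) (by simp)]

end RealRAM

/-! ### Running time and approximation guarantee -/

theorem clog_two_le {n : ℕ} (hn : 2 ≤ n) : (Nat.clog 2 n : ℝ) ≤ 3 * Real.log n := by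
  have hn' : (0 : ℝ) < n := by positivity
  have h1 : ((Nat.clog 2 n - 1 : ℕ) : ℝ) * Real.log 2 ≤ Real.log n := by
    rw [← Real.log_pow]
    refine Real.log_le_log (by positivity) ?_
    exact_mod_cast (Nat.pow_pred_clog_lt_self (b := 2) (by decide) (by omega)).le
  have h2 : 1 ≤ Nat.clog 2 n := Nat.clog_pos (by decide) hn
  have h3 : Real.log 2 ≤ Real.log n := Real.log_le_log two_pos (by exact_mod_cast hn)
  rw [Nat.cast_sub h2, Nat.cast_one] at h1
  have h4 := Real.log_two_gt_d9
  have h5 : (1 : ℝ) ≤ Nat.clog 2 n := by exact_mod_cast h2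
  nlinarith

namespace RealRAM

theorem runningTime_le {n m : ℕ} {δ : ℝ} (hn : 2 ≤ n) (hδ : 0 < δ) :
    ((powerSteps n δ * (80 * (n + m) + 60) + Nat.clog 2 n * (200 * n + 54) + 300 * (n + m) + 200 :
      ℕ) : ℝ) ≤ 40000 * max 1 (δ ^ 2)⁻¹ * ((n : ℝ) + m) * Real.log n := by
  set M := max 1 (δ ^ 2)⁻¹ with hM
  have hM1 : 1 ≤ M := le_max_left _ _
  set L : ℝ := (Nat.clog 2 n : ℝ) with hL
  have hL1 : 1 ≤ L := Nat.one_le_cast.2 (Nat.clog_pos (by decide) hn)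
  have hn' : (2 : ℝ) ≤ n := by exact_mod_cast hn
  set N : ℝ := (n : ℝ) + m with hN
  have hm : (0 : ℝ) ≤ m := Nat.cast_nonneg m
  have hK : (powerSteps n δ : ℝ) ≤ 101 * (L * M) := by
    have h1 : (⌊100 * L / δ ^ 2⌋₊ : ℝ) ≤ 100 * L * M := by
      refine (Nat.floor_le (by positivity)).trans ?_
      rw [div_eq_mul_inv]
      gcongr
      exact le_max_right _ _
    have h2 : 1 ≤ L * M := one_le_mul_of_one_le_of_one_le hL1 hM1
    rw [powerSteps]
    push_cast
    linarith
  have hLM : L ≤ L * M := le_mul_of_one_le_right (by linarith) hM1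
  push_cast
  calc (powerSteps n δ : ℝ) * (80 * (n + m) + 60) + L * (200 * n + 54) + 300 * (n + m) + 200
      ≤ (101 * (L * M)) * (110 * N) + (L * M) * (227 * N) + (L * M) * (400 * N) := by
        have h3 : 300 * (n + m) + 200 ≤ (L * M) * (400 * N) := by
          have : 400 * N ≤ (L * M) * (400 * N) :=
            le_mul_of_one_le_left (by positivity) (one_le_mul_of_one_le_of_one_le hL1 hM1)
          linarith
        rw [add_assoc]
        refine add_le_add (add_le_add ?_ ?_) h3
        · gcongr; linarith
        · gcongr; linarith
    _ ≤ 12000 * M * N * L := by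
        have : 0 ≤ M * N * L := by positivity
        linarith
    _ ≤ 12000 * M * N * (3 * Real.log n) := by gcongr; exact clog_two_le hn
    _ ≤ 40000 * M * N * Real.log n := by
        have : 0 ≤ M * N * Real.log n := mul_nonneg (by positivity) (Real.log_nonneg (by linarith))
        linarith

end RealRAM

theorem sqrt_sixteen_mul_add_le (ε : ℝ) {δ : ℝ} (hδ : 0 < δ) :
    √(4 * (2 * (2 * ε + δ ^ 2 / 8))) ≤ 4 * √ε + δ := by
  rw [Real.sqrt_le_left (by positivity)]
  have h1 : ε ≤ √ε ^ 2 := by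
    rcases le_total 0 ε with h | h
    · rw [Real.sq_sqrt h]
    · exact h.trans (sq_nonneg _)
  nlinarith [mul_nonneg (Real.sqrt_nonneg ε) hδ.le]

theorem theorem1 :
    ∃ (P : RealRAM.Cmd) (C : ℝ),
      ∀ (n : ℕ) (G : WeightedGraph (Fin n)) (l : List (Fin n × Fin n)) (δ : ℝ),
        G.IsEdgeList l → 0 < G.totalWeight → 0 < δ →
        (∀ ω : ℕ → Bool, ∃ (t : ℕ) (s : RealRAM.State),
          RealRAM.Exec ω P (RealRAM.input G l δ) t s ∧
          (t : ℝ) ≤ C * max 1 (δ ^ 2)⁻¹ * ((n : ℝ) + (G.graph.edgeSet.ncard : ℝ)) *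
            Real.log (n : ℝ)) ∧
        ∀ ε : ℝ, 1 - ε ≤ G.maxCut →
          2 / 3 ≤ RealRAM.coinMeasure {ω : ℕ → Bool |
            ∃ (t : ℕ) (s : RealRAM.State) (y : Fin n → ℝ),
              RealRAM.Exec ω P (RealRAM.input G l δ) t s ∧
              y = RealRAM.output n s ∧
              (∀ i, y i = -1 ∨ y i = 0 ∨ y i = 1) ∧
              0 < ∑ i, G.degree i * |y i| ∧
              (∑ i, ∑ j, G.weight i j * |y i + y j|) / (∑ i, G.degree i * |y i|) ≤
                4 * Real.sqrt ε + δ} := by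
  refine ⟨RealRAM.spectralCut, 40000, fun n G l δ hl hG hδ => ⟨fun ω => ?_, fun ε hε => ?_⟩⟩
  · obtain ⟨t, s, hexec, ht, -⟩ := RealRAM.runs_spectralCut (ω := ω) hl hδ
    refine ⟨t, s, hexec, ?_⟩
    rw [G.length_edgeList hl]
    exact (Nat.cast_le.2 ht).trans (RealRAM.runningTime_le (G.two_le_of_totalWeight_pos hG) hδ)
  · obtain ⟨v, hv, hgood⟩ := G.exists_good_direction hG
    refine (RealRAM.two_thirds_le_coinMeasure hv).trans (MeasureTheory.measure_mono fun ω hω => ?_)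
    obtain ⟨t, s, hexec, -, hy⟩ := RealRAM.runs_spectralCut (ω := ω) hl hδ
    have hstart : ∑ i : Fin n, RealRAM.start ω i ^ 2 ≤ 9 * n := by
      calc ∑ i : Fin n, RealRAM.start ω i ^ 2 ≤ ∑ _i : Fin n, (3 : ℝ) ^ 2 := by
            gcongr with i
            · exact RealRAM.start_nonneg ω i
            · exact RealRAM.start_le ω i
        _ = 9 * n := by simp; ring
    obtain ⟨hS, hR⟩ := hgood hδ hε hstart hω
    obtain ⟨hvol, hcut⟩ := hy.uncut_le
      (fun i hi => by simp [RealRAM.powerVector, G.scale_eq_zero hi]) hS hR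
    refine ⟨t, s, _, hexec, rfl, fun i => ?_, hvol, ?_⟩
    · obtain ⟨σ, b, -, hout, -⟩ := hy
      rw [hout, WeightedGraph.prefixCut]
      split_ifs
      · rcases signOf_eq (RealRAM.powerVector G δ ω i) with h | h <;> simp [h]
      · simp
    · change G.uncut _ / G.volume _ ≤ _
      rw [div_le_iff₀ hvol]
      exact hcut.trans (mul_le_mul_of_nonneg_right (sqrt_sixteen_mul_add_le ε hδ) hvol.le)
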